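/- Let $\mathcal B$ be a real Banach space with $\dim\mathcal B\ge 2$, and write $B_r=\{x\in\mathcal B:\|x\|\le r\}$. A point $x$ of a normed space $E$ is *rotund* if for every $y\in E$ with $\|y\|=\|x\|$, the equality $\|y\|=\|\tfrac{x+y}{2}\|$ implies $x=y$. Assume that $\mathcal B$ is *uniformly non-rotund*: for every $0\ne f\in\mathcal B$ and every two-dimensional subspace $X\subset\mathcal B$ containing $f$, the point $f$ is not rotund in $X$. Let $$J(f)=\{L\in\mathcal B^*: L(f)=\|L\|\,\|f\|,\ \|L\|=\|f\|\}$$ be the duality mapping. A functional $L\in\mathcal B^*$ *exposes* $F\subset B_r$ if $F=\{x\in B_r: L(x)=\sup_{y\in B_r}L(y)\}$; an *exposed face* of $B_r$ is a non-empty set exposed by some $L\ne 0$. Let $\Omega:\mathcal B\to\mathbb R$. For an exposed face $F$ of $B_r$ and $f\in F$, say that the *tangential bound* holds at $f$ if $\Omega(f+f_T)\ge\Omega(f)$ for every $L\in J(f)$ exposing $F$ and every $f_T\in\ker L$. Suppose that for every $r>0$ and every exposed face $F$ of $B_r$, $\Omega$ attains its minimum over $F$ in at least one point, and that the tangential bound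 holds at every $f\in F$ at which this minimum is attained. Call $\hat f\in\mathcal B$ *admissible* if, for some $r\ge 0$, it minimises $\Omega$ over some exposed face $F$ of $B_r$ with $\hat f\in F$ and the tangential bound holds at $\hat f$ (for $\hat f=0$, $r=0$, $F=\{0\}$ this just says that $0$ is a global minimiser of $\Omega$). Then every admissible $\hat f\in\mathcal B$ satisfies $$\Omega(\hat f)\le\Omega(f)\qquad\text{for all } f\in\mathcal B \text{ with } \|f\|>\|\hat f\|.$$ -/

import Mathlib

/-- A point `x` of a real normed space is rotund if, whenever `‖y‖ = ‖x‖` and the midpoint of `x`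
and `y` has that same norm, then `x = y`. -/
def IsRotundPoint {E : Type*} [NormedAddCommGroup E] [NormedSpace ℝ E] (x : E) : Prop :=
  ∀ y : E, ‖y‖ = ‖x‖ → ‖y‖ = ‖(1 / 2 : ℝ) • (x + y)‖ → x = y

/-- `f ≠ 0` is uniformly non-rotund if it is not a rotund point of any two-dimensional subspace
containing it. -/
def IsUniformlyNonRotundPoint {B : Type*} [NormedAddCommGroup B] [NormedSpace ℝ B] (f : B) : Prop :=
  f ≠ 0 ∧ ∀ X : Submodule ℝ B, Module.finrank ℝ X = 2 →
    ∀ hf : f ∈ X, ¬ IsRotundPoint (⟨f, hf⟩ : X)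

/-- A space is uniformly non-rotund if all its nonzero points are. -/
def UniformlyNonRotund (B : Type*) [NormedAddCommGroup B] [NormedSpace ℝ B] : Prop :=
  ∀ f : B, f ≠ 0 → IsUniformlyNonRotundPoint f

/-- The duality mapping `J(f) = {L ∈ B* : L(f) = ‖L‖ ‖f‖, ‖L‖ = ‖f‖}`. -/
def dualityMap {B : Type*} [NormedAddCommGroup B] [NormedSpace ℝ B] (f : B) :
    Set (StrongDual ℝ B) :=
  {L | L f = ‖L‖ * ‖f‖ ∧ ‖L‖ = ‖f‖}

/-- `L` exposes the subset `F` of the closed ball `B_r` of radius `r` around the origin: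
`F` is the set of the points of `B_r` at which `L` attains its supremum over `B_r`. -/
def Exposes {B : Type*} [NormedAddCommGroup B] [NormedSpace ℝ B] (L : StrongDual ℝ B)
    (r : ℝ) (F : Set B) : Prop :=
  F = {x ∈ Metric.closedBall (0 : B) r | L x = sSup (L '' Metric.closedBall (0 : B) r)}

/-- Exposed faces of `B_r`: nonempty sets exposed by a nonzero functional. (The zero functional
only exposes the ball itself.) -/
def IsExposedFace {B : Type*} [NormedAddCommGroup B] [NormedSpace ℝ B] (r : ℝ) (F : Set B) :
    Prop :=
  F.Nonempty ∧ ∃ L : StrongDual ℝ B, L ≠ 0 ∧ Exposes L r F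

/-- The tangential bound at a point `f` of a face `F` of `B_r`: `Ω` does not drop below `Ω f` along
the kernel of any `L ∈ J(f)` exposing `F`. -/
def TangentialBound {B : Type*} [NormedAddCommGroup B] [NormedSpace ℝ B] (Ω : B → ℝ)
    (r : ℝ) (F : Set B) (f : B) : Prop :=
  ∀ L ∈ dualityMap f, Exposes L r F → ∀ fT : B, L fT = 0 → Ω f ≤ Ω (f + fT)

/-- `Ω` attains its minimum on every exposed face of every ball, and satisfies the tangential bound
at every point of the face where this minimum is attained. -/
def MinimaTangentiallyNondecreasing {B : Type*} [NormedAddCommGroup B] [NormedSpace ℝ B]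
    (Ω : B → ℝ) : Prop :=
  ∀ r : ℝ, 0 < r → ∀ F : Set B, IsExposedFace r F →
    (∃ f ∈ F, IsMinOn Ω F f) ∧ ∀ f ∈ F, IsMinOn Ω F f → TangentialBound Ω r F f

/-- Admissible points: minimisers of `Ω` over an exposed face at which the tangential bound holds.
(For the degenerate radius `r = 0` the only face is `{0}` and the bound says that `0` is a global
minimiser of `Ω`.) -/
def IsAdmissiblePoint {B : Type*} [NormedAddCommGroup B] [NormedSpace ℝ B] (Ω : B → ℝ)
    (f : B) : Prop :=
  ∃ (r : ℝ) (F : Set B), 0 ≤ r ∧ IsExposedFace r F ∧ f ∈ F ∧ IsMinOn Ω F f ∧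
    TangentialBound Ω r F f

/-! Suppose `Ω` drops below `Ω fhat` at some g with ‖g‖ > r = ‖fhat‖, where r > 0, and let D be the
sublevel set {Ω < Ω fhat}. If L of norm one exposes the face of `fhat`, the tangential bound at
`fhat` says that D misses the hyperplane L = r. The contradiction comes from showing that D meets
it.

The tangential bound at face minimisers provides the only move
(`MinimaTangentiallyNondecreasing.isFaceClosed`): from g ∈ D one may slide inside the hyperplane M =
M g to a point of D on the face of M in the ball of radius M g. Such moves can only lower the norm,
so the loss has to be controlled.

Rotation (`IsFaceClosed.exists_rotate`): passing to the face of another functional in n small steps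
costs O(1/n) in norm, because the losses telescope. Bishop–Phelps supplies the norm attaining
functionals along the way.

Corners (`IsFaceClosed.exists_mem_corner`): if distinct functionals support the unit ball at one
point, rotate slightly past the end of the segment of supporting functionals. Interpolating between
two functionals of that segment then produces a prescribed norm and lands in their common face, so D
meets this face at every radius below ‖g‖.

Non-rotundity supplies the corners: on the face of L itself if ker L has dimension at least two
(`UniformlyNonRotund.exists_corner_of_kernel`), and arbitrarily close to it in a plane
(`UniformlyNonRotund.exists_corner_of_plane`). `IsFaceClosed.exists_map_eq` combines these. -/

/-- A functional of norm one that attains its norm on the unit sphere. -/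
def IsUnitNormAttaining {B : Type*} [NormedAddCommGroup B] [NormedSpace ℝ B]
    (M : StrongDual ℝ B) : Prop :=
  ‖M‖ = 1 ∧ ∃ x : B, ‖x‖ = 1 ∧ M x = 1

/-! ### Ekeland's principle and the Bishop–Phelps theorem -/

/-- A variational principle of Ekeland type. -/
theorem exists_forall_sub_le_mul_dist {X : Type*} [MetricSpace X] [CompleteSpace X]
    {C : Set X} (hC : IsClosed C) (hne : C.Nonempty) {φ : X → ℝ} (hφ : Continuous φ)
    {K : ℝ} (hK : ∀ x ∈ C, φ x ≤ K) {δ : ℝ} (hδ : 0 < δ) :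
    ∃ x ∈ C, ∀ y ∈ C, φ y - φ x ≤ δ * dist y x := by
  -- Each new point dominates x and comes within 2⁻ⁿ of the supremum of `φ` over the points
  -- dominating x. Hence nothing dominating the limit can have a larger value.
  have step : ∀ (n : ℕ) (x : C), ∃ y : C, δ * dist (y : X) x ≤ φ y - φ x ∧
      ∀ z ∈ C, δ * dist z (x : X) ≤ φ z - φ x → φ z ≤ φ y + (1 / 2 : ℝ) ^ n := by
    intro n x
    set S : Set ℝ := φ '' {z | z ∈ C ∧ δ * dist z (x : X) ≤ φ z - φ x} with hS
    have hSne : S.Nonempty := ⟨φ x, x, ⟨x.2, by simp⟩, rfl⟩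
    have hSb : BddAbove S := ⟨K, by rintro _ ⟨z, hz, rfl⟩; exact hK z hz.1⟩
    obtain ⟨_, ⟨y, hy, rfl⟩, hlt⟩ := exists_lt_of_lt_csSup hSne
      (sub_lt_self (sSup S) (show (0 : ℝ) < (1 / 2) ^ n by positivity))
    refine ⟨⟨y, hy.1⟩, hy.2, fun z hz hz' => ?_⟩
    have := le_csSup hSb ⟨z, ⟨hz, hz'⟩, rfl⟩
    simp only
    linarith
  choose next hnext hmax using step
  obtain ⟨x0, hx0⟩ := hne
  obtain ⟨x, hx⟩ : ∃ x : ℕ → C, ∀ n, x (n + 1) = next n (x n) :=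
    ⟨fun n => Nat.rec ⟨x0, hx0⟩ (fun n y => next n y) n, fun n => rfl⟩
  have hdist : ∀ m n : ℕ, δ * dist (x (n + m)).1 (x n).1 ≤ φ (x (n + m)).1 - φ (x n).1 := by
    intro m n
    induction m with
    | zero => simp
    | succ k ih =>
      have h1 := hnext (n + k) (x (n + k))
      rw [← hx] at h1
      have h2 := dist_triangle (x (n + (k + 1)) : X) (x (n + k)) (x n)
      have h3 := mul_le_mul_of_nonneg_left h2 hδ.le
      rw [← add_assoc] at *
      linarith
  have hmono : Monotone fun n => φ (x n).1 := by
    refine monotone_nat_of_le_succ fun n => ?_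
    have := hdist 1 n
    have h0 : 0 ≤ δ * dist (x (n + 1) : X) (x n) := by positivity
    linarith
  have hbdd : BddAbove (Set.range fun n => φ (x n).1) :=
    ⟨K, by rintro _ ⟨n, rfl⟩; exact hK _ (x n).2⟩
  have hlim := tendsto_atTop_ciSup hmono hbdd
  set l := ⨆ n, φ (x n).1 with hl
  have hle : ∀ n, φ (x n).1 ≤ l := fun n => le_ciSup hbdd n
  have hcau : CauchySeq fun n => (x n : X) := by
    refine Metric.cauchySeq_iff'.2 fun ε hε => ?_
    obtain ⟨N, hN⟩ := (hlim.eventually (lt_mem_nhds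
      (show l - δ * ε < l by nlinarith [mul_pos hδ hε]))).exists
    refine ⟨N, fun n hn => ?_⟩
    obtain ⟨m, rfl⟩ := Nat.exists_eq_add_of_le hn
    have h1 := hdist m N
    have h2 := hle (N + m)
    have h3 : δ * dist (x (N + m) : X) (x N) < δ * ε := by linarith
    exact lt_of_mul_lt_mul_left h3 hδ.le
  obtain ⟨a, ha⟩ := cauchySeq_tendsto_of_complete hcau
  have haC : a ∈ C := hC.mem_of_tendsto ha (Filter.Eventually.of_forall fun n => (x n).2)
  have hφa : φ a = l := tendsto_nhds_unique ((hφ.tendsto a).comp ha) hlim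
  have had : ∀ n, δ * dist a (x n) ≤ φ a - φ (x n).1 := by
    intro n
    have h1 : Filter.Tendsto (fun m => δ * dist (x m : X) (x n)) Filter.atTop
        (nhds (δ * dist a (x n))) := (ha.dist tendsto_const_nhds).const_mul δ
    have h2 : Filter.Tendsto (fun m => φ (x m).1 - φ (x n).1) Filter.atTop
        (nhds (φ a - φ (x n).1)) := ((hφ.tendsto a).comp ha).sub_const _
    refine le_of_tendsto_of_tendsto h1 h2 ?_
    filter_upwards [Filter.eventually_ge_atTop n] with m hm
    obtain ⟨k, rfl⟩ := Nat.exists_eq_add_of_le hm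
    exact hdist k n
  refine ⟨a, haC, fun y hy => ?_⟩
  by_contra! hlt
  have hy1 : ∀ n : ℕ, φ y ≤ φ a + (1 / 2 : ℝ) ^ n := by
    intro n
    have h1 := mul_le_mul_of_nonneg_left (dist_triangle y a (x n)) hδ.le
    have h2 := hmax n (x n) y hy (by linarith [had n])
    rw [← hx] at h2
    have := hle (n + 1)
    linarith
  have hy2 : φ y ≤ φ a := by
    have : Filter.Tendsto (fun n : ℕ => φ a + (1 / 2 : ℝ) ^ n) Filter.atTop (nhds (φ a + 0)) :=
      (tendsto_pow_atTop_nhds_zero_of_lt_one (by norm_num) (by norm_num)).const_add _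
    simpa using ge_of_tendsto' this hy1
  have : 0 ≤ δ * dist y a := by positivity
  linarith

/-- At an almost maximal point of `L` over a convex set, a small perturbation of `L` is
maximal. -/
theorem exists_norm_sub_le_forall_le {B : Type*} [NormedAddCommGroup B] [NormedSpace ℝ B]
    {C : Set B} (hC : Convex ℝ C) {x : B} (hx : x ∈ C) (L : StrongDual ℝ B) {δ : ℝ}
    (hδ : 0 < δ) (hL : ∀ y ∈ C, L y - L x ≤ δ * dist y x) :
    ∃ G : StrongDual ℝ B, ‖L - G‖ ≤ δ ∧ ∀ y ∈ C, G y ≤ G x := by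
  -- With x moved to the origin, the hypothesis says that the open cone over δ‖·‖ misses the part of
  -- the hypograph of L above C − x. A separating hyperplane is the graph of some H with H ≤ δ‖·‖
  -- everywhere and L ≤ H on C − x; then G = L − H.
  set s : Set (B × ℝ) := {p | δ * ‖p.1‖ < p.2} with hs
  set t : Set (B × ℝ) := {p | x + p.1 ∈ C ∧ p.2 ≤ L p.1} with ht
  have hso : IsOpen s := isOpen_lt (by fun_prop) (by fun_prop)
  have hsc : Convex ℝ s := by
    rintro ⟨a, α⟩ ha ⟨b, β⟩ hb u v hu hv huv
    simp only [hs, Set.mem_ofPred_eq, Prod.smul_mk, Prod.mk_add_mk, smul_eq_mul] at *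
    have h1 : ‖u • a + v • b‖ ≤ u * ‖a‖ + v * ‖b‖ := by
      refine (norm_add_le _ _).trans ?_
      rw [norm_smul, norm_smul, Real.norm_of_nonneg hu, Real.norm_of_nonneg hv]
    have h2 := mul_le_mul_of_nonneg_left h1 hδ.le
    rcases hu.eq_or_lt with rfl | hu'
    · have : v = 1 := by linarith
      subst this; simpa using hb
    · nlinarith [mul_lt_mul_of_pos_left ha hu', mul_le_mul_of_nonneg_left hb.le hv]
  have htc : Convex ℝ t := by
    rintro ⟨a, α⟩ ha ⟨b, β⟩ hb u v hu hv huv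
    simp only [ht, Set.mem_ofPred_eq, Prod.smul_mk, Prod.mk_add_mk, smul_eq_mul, map_add,
      map_smul] at *
    refine ⟨?_, add_le_add (mul_le_mul_of_nonneg_left ha.2 hu) (mul_le_mul_of_nonneg_left hb.2 hv)⟩
    have h1 := hC ha.1 hb.1 hu hv huv
    have h2 : u • (x + a) + v • (x + b) = x + (u • a + v • b) := by
      have : u • (x + a) + v • (x + b) = (u + v) • x + (u • a + v • b) := by module
      rw [this, huv, one_smul]
    rwa [h2] at h1
  have hdisj : Disjoint s t := by
    refine Set.disjoint_left.2 ?_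
    rintro ⟨a, α⟩ ha hb
    have h1 := hL _ hb.1
    have h2 : α ≤ L a := hb.2
    have h3 : δ * ‖a‖ < α := ha
    simp only [map_add, dist_eq_norm, add_sub_cancel_left] at h1
    exact absurd (h2.trans h1) (not_le.2 h3)
  obtain ⟨f, u, hfs, hft⟩ := geometric_hahn_banach_open hsc hso htc hdisj
  set c := f (0, 1) with hc
  have hf : ∀ z α, f (z, α) = f (z, 0) + α * c := by
    intro z α
    have : ((z, α) : B × ℝ) = (z, 0) + α • (0, 1) := by simp
    rw [this, map_add, map_smul, smul_eq_mul]
  have hu0 : u ≤ 0 := by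
    have := hft (0, 0) (by simp [ht, hx])
    rwa [Prod.mk_zero_zero, map_zero] at this
  have hc0 : c < 0 := (hfs (0, 1) (by simp [hs])).trans_le hu0
  have hu : u = 0 := by
    refine le_antisymm hu0 ?_
    by_contra! hneg
    have h1 := hfs (0, u / (2 * c)) (by
      simp only [hs, Set.mem_ofPred_eq, norm_zero, mul_zero]
      exact div_pos_of_neg_of_neg hneg (by linarith))
    rw [hf, Prod.mk_zero_zero, map_zero, zero_add] at h1
    have : u / (2 * c) * c = u / 2 := by field_simp [hc0.ne]
    linarith
  subst hu
  set H : StrongDual ℝ B := (-c)⁻¹ • f.comp (ContinuousLinearMap.inl ℝ B ℝ) with hH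
  have hHz : ∀ z, (-c) * H z = f (z, 0) := by
    intro z
    simp only [hH, smul_apply, ContinuousLinearMap.comp_apply,
      ContinuousLinearMap.inl_apply, smul_eq_mul]
    rw [← mul_assoc, mul_inv_cancel₀ (by linarith), one_mul]
  have hHle : ∀ z, H z ≤ δ * ‖z‖ := by
    intro z
    by_contra! hlt
    have h1 := hfs (z, H z) hlt
    rw [hf, ← hHz] at h1
    linarith
  have hHge : ∀ z, x + z ∈ C → L z ≤ H z := by
    intro z hz
    have h1 := hft (z, L z) ⟨hz, le_rfl⟩
    rw [hf, ← hHz] at h1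
    have : 0 ≤ (-c) * (H z - L z) := by linarith
    have := nonneg_of_mul_nonneg_right this (by linarith)
    linarith
  refine ⟨L - H, ?_, fun y hy => ?_⟩
  · rw [sub_sub_cancel]
    refine ContinuousLinearMap.opNorm_le_bound _ hδ.le fun z => ?_
    rw [Real.norm_eq_abs, abs_le]
    have := hHle (-z)
    rw [map_neg, norm_neg] at this
    exact ⟨by linarith, hHle z⟩
  · have := hHge (y - x) (by simpa using hy)
    simp only [map_sub, sub_apply] at *
    linarith

/-- **Bishop–Phelps theorem**: norm attaining functionals are dense. -/
theorem exists_isUnitNormAttaining_norm_sub_le {B : Type*} [NormedAddCommGroup B]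
    [NormedSpace ℝ B] [CompleteSpace B] {L : StrongDual ℝ B} (hL : ‖L‖ = 1) {δ : ℝ}
    (hδ : 0 < δ) : ∃ G : StrongDual ℝ B, IsUnitNormAttaining G ∧ ‖L - G‖ ≤ δ := by
  -- One η pays for the distance from L to G, the other for normalising G; η < 1 keeps G nonzero.
  obtain ⟨η, hη, hηδ, hη1⟩ : ∃ η : ℝ, 0 < η ∧ 2 * η ≤ δ ∧ η < 1 :=
    ⟨min (δ / 2) (1 / 2), by positivity, by linarith [min_le_left (δ / 2) (1 / 2)],
      by linarith [min_le_right (δ / 2) (1 / 2)]⟩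
  obtain ⟨x, hx, hxmax⟩ := exists_forall_sub_le_mul_dist
    (Metric.isClosed_closedBall (x := (0 : B)) (ε := 1)) ⟨0, by simp⟩ L.continuous (K := 1)
    (fun y hy => by
      have := L.le_opNorm y
      rw [hL, one_mul] at this
      exact (le_abs_self _).trans (this.trans (by simpa using hy))) hη
  obtain ⟨G, hGL, hG⟩ := exists_norm_sub_le_forall_le (convex_closedBall (0 : B) 1) hx L hη hxmax
  have hGn : |1 - ‖G‖| ≤ η := by
    have := abs_norm_sub_norm_le L G
    rw [hL] at this
    exact this.trans hGL
  have hGpos : 0 < ‖G‖ := by linarith [(abs_le.1 hGn).2]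
  have hx1 : ‖x‖ ≤ 1 := by simpa using hx
  have hGx : ‖G‖ ≤ G x := by
    have h0 : 0 ≤ G x := by simpa using hG 0 (by simp)
    refine ContinuousLinearMap.opNorm_le_of_unit_norm h0 fun y hy => ?_
    have h1 := hG y (by simp [hy])
    have h2 := hG (-y) (by simp [hy])
    rw [map_neg] at h2
    rw [Real.norm_eq_abs, abs_le]
    exact ⟨by linarith, h1⟩
  have hGx' : G x ≤ ‖G‖ * ‖x‖ := (le_abs_self _).trans (G.le_opNorm x)
  have hxn : ‖x‖ = 1 := le_antisymm hx1 (by nlinarith)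
  refine ⟨‖G‖⁻¹ • G, ⟨by rw [norm_smul, norm_inv, norm_norm, inv_mul_cancel₀ hGpos.ne'],
    x, hxn, ?_⟩, ?_⟩
  · have : G x = ‖G‖ := le_antisymm (by rw [hxn, mul_one] at hGx'; exact hGx') hGx
    simp [this, hGpos.ne']
  · have h1 : ‖G - ‖G‖⁻¹ • G‖ = |1 - ‖G‖| := by
      have : G - ‖G‖⁻¹ • G = (1 - ‖G‖⁻¹) • G := by module
      rw [this, norm_smul, Real.norm_eq_abs, ← abs_of_pos hGpos, ← abs_mul, abs_of_pos hGpos,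
        sub_mul, inv_mul_cancel₀ hGpos.ne', one_mul, abs_sub_comm]
    calc ‖L - ‖G‖⁻¹ • G‖ ≤ ‖L - G‖ + ‖G - ‖G‖⁻¹ • G‖ := norm_sub_le_norm_sub_add_norm_sub _ _ _
      _ ≤ δ := by rw [h1]; linarith

/-! ### Face-closed sets and rotation between faces -/

/-- A set `D` meets, together with any point `g`, the face of each centred ball whose supporting
hyperplane passes through `g`. -/
def IsFaceClosed {B : Type*} [NormedAddCommGroup B] [NormedSpace ℝ B] (D : Set B) : Prop :=
  ∀ g ∈ D, ∀ M : StrongDual ℝ B, IsUnitNormAttaining M → 0 < M g →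
    ∃ h ∈ D, ‖h‖ = M g ∧ M h = M g

section

variable {B : Type*} [NormedAddCommGroup B] [NormedSpace ℝ B]

theorem le_norm_of_norm_le_one {M : StrongDual ℝ B} (hM : ‖M‖ ≤ 1) (x : B) : M x ≤ ‖x‖ := by
  have := M.le_of_opNorm_le hM x
  rw [one_mul] at this
  exact (le_abs_self _).trans this

theorem le_opNorm_of_norm_eq_one (M : StrongDual ℝ B) {x : B} (hx : ‖x‖ = 1) : M x ≤ ‖M‖ := by
  have := M.le_opNorm x
  rw [hx, mul_one] at this
  exact (le_abs_self _).trans this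

theorem norm_inv_smul_self {x : B} (hx : 0 < ‖x‖) : ‖‖x‖⁻¹ • x‖ = 1 := by
  rw [norm_smul, norm_inv, norm_norm, inv_mul_cancel₀ hx.ne']

theorem map_eq_norm_mul_map_unit (M : StrongDual ℝ B) {x : B} (hx : 0 < ‖x‖) :
    M x = ‖x‖ * M (‖x‖⁻¹ • x) := by
  rw [map_smul, smul_eq_mul, ← mul_assoc, mul_inv_cancel₀ hx.ne', one_mul]

/-- Passing from a point of the face of a functional `G` near `N` to the face of a functional `G'`
near `N + Δ • E` costs little. -/
theorem mul_one_sub_le_of_near {N E G G' : StrongDual ℝ B} {Δ δ κ : ℝ}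
    (hG : ‖N - ‖N‖ • G‖ ≤ δ) (hG' : ‖(N + Δ • E) - ‖N + Δ • E‖ • G'‖ ≤ δ)
    (hG'1 : ‖G'‖ = 1) (hκ : κ ≤ ‖N + Δ • E‖) {u w : B} (hu : ‖u‖ = 1) (hw : ‖w‖ = 1)
    (hGu : G u = 1) (hG'w : G' w = 1) :
    κ * (1 - G' u) ≤ Δ * (E w - E u) + 3 * δ := by
  set N' := N + Δ • E with hN'
  have hN'x : ∀ x, N' x = N x + Δ * E x := fun x => by simp [hN']
  have h1 := (le_opNorm_of_norm_eq_one _ hu).trans ((norm_neg (N - ‖N‖ • G)).le.trans hG)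
  have h2 := (le_opNorm_of_norm_eq_one _ hu).trans hG'
  have h3 := (le_opNorm_of_norm_eq_one _ hw).trans ((norm_neg (N' - ‖N'‖ • G')).le.trans hG')
  have h4 := le_opNorm_of_norm_eq_one N hw
  simp only [neg_apply, sub_apply, smul_apply, smul_eq_mul, hGu, hG'w, hN'x] at h1 h2 h3
  have h5 : G' u ≤ 1 := hu ▸ le_norm_of_norm_le_one hG'1.le u
  have h6 := mul_le_mul_of_nonneg_right hκ (sub_nonneg.2 h5)
  nlinarith

/-- The norm is bounded below along a segment in the dual space that misses the origin. -/
theorem exists_pos_le_norm_add_smul {L M : StrongDual ℝ B} (hL : ‖L‖ = 1) (hM : ‖M‖ = 1)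
    (hne : M ≠ -L) : ∃ κ > 0, ∀ θ ∈ Set.Icc (0 : ℝ) 1, κ ≤ ‖L + θ • (M - L)‖ := by
  obtain ⟨θ₀, hθ₀, hmin⟩ := isCompact_Icc.exists_isMinOn (Set.nonempty_Icc.2 zero_le_one)
    (f := fun θ : ℝ => ‖L + θ • (M - L)‖) (by fun_prop)
  refine ⟨‖L + θ₀ • (M - L)‖, norm_pos_iff.2 fun h0 => hne ?_, fun θ hθ => hmin hθ⟩
  have h1 : (1 - θ₀) • L = -(θ₀ • M) := by
    rw [← sub_eq_zero, ← h0]; module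
  have h2 := congrArg norm h1
  rw [norm_neg, norm_smul, norm_smul, hL, hM, Real.norm_of_nonneg (sub_nonneg.2 hθ₀.2),
    Real.norm_of_nonneg hθ₀.1] at h2
  have h3 : θ₀ = 1 / 2 := by linarith
  rw [h3] at h1
  have h4 : (1 / 2 : ℝ) • (M + L) = 0 := by
    have : (1 / 2 : ℝ) • (M + L) = (1 - 1 / 2 : ℝ) • L - -((1 / 2 : ℝ) • M) := by module
    rw [this, h1, sub_self]
  exact eq_neg_of_add_eq_zero_left ((smul_eq_zero.1 h4).resolve_left (by norm_num))

/-- In dimension at least two every functional has a nontrivial kernel. -/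
theorem exists_ne_zero_map_eq_zero (hdim : 2 ≤ Module.rank ℝ B) (L : StrongDual ℝ B) :
    ∃ v : B, v ≠ 0 ∧ L v = 0 := by
  by_contra! hcon
  have hinj : Function.Injective (L : B →ₗ[ℝ] ℝ) := by
    refine (injective_iff_map_eq_zero _).2 fun v hv => ?_
    by_contra h0
    exact hcon v h0 hv
  have h1 := LinearMap.lift_rank_le_of_injective _ hinj
  rw [Module.rank_self, Cardinal.lift_one, Cardinal.lift_le_one_iff] at h1
  exact absurd (hdim.trans h1) (by simp)

variable [CompleteSpace B] {D : Set B}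

/-- Follow the segment from L to M in n steps. It misses the origin, so its points can be normalised
and approximated by norm attaining functionals, with a face move at each step. A single loss is of
order 1/n, but the main terms telescope, leaving a total of order 1/n. -/
theorem IsFaceClosed.exists_rotate_of_ne_neg (hD : IsFaceClosed D) {L M : StrongDual ℝ B}
    (hL : IsUnitNormAttaining L) (hM : IsUnitNormAttaining M) (hne : M ≠ -L) {g : B} (hg : g ∈ D)
    (hg0 : 0 < ‖g‖) (hLg : L g = ‖g‖) {t : ℝ} (ht : t < ‖g‖) :
    ∃ h ∈ D, t < ‖h‖ ∧ ‖h‖ ≤ ‖g‖ ∧ M h = ‖h‖ := by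
  obtain ⟨κ, hκ0, hκ⟩ := exists_pos_le_norm_add_smul hL.1 hM.1 hne
  set s := ‖g‖ with hs
  set E := M - L with hE
  obtain ⟨n, hn⟩ := exists_nat_gt (7 * s / (κ * (s - max t 0)))
  have hst : 0 < s - max t 0 := by rw [sub_pos]; exact max_lt ht hg0
  have hn0 : (0 : ℝ) < n := lt_of_le_of_lt (by positivity) hn
  rw [div_lt_iff₀ (by positivity)] at hn
  have hn' : 7 / n * s < κ * (s - max t 0) := by
    rw [div_mul_eq_mul_div, div_lt_iff₀ hn0]; linarith
  have hn7 : 7 / n < κ := by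
    have h1 : 7 / n * s < κ * s := hn'.trans_le (by nlinarith [le_max_right t 0])
    exact lt_of_mul_lt_mul_right h1 hg0.le
  have hEu : ∀ u : B, ‖u‖ = 1 → |E u| ≤ 2 := by
    intro u hu
    have h1 := E.le_opNorm u
    rw [hu, mul_one] at h1
    refine h1.trans ((norm_sub_le _ _).trans ?_)
    rw [hL.1, hM.1]; norm_num
  set δ : ℝ := 1 / n ^ 2 with hδ
  have hδ0 : 0 < δ := by positivity
  have hnat : n ≠ 0 := by rintro rfl; simp at hn0
  -- The end functionals are kept exact, so that the rotation starts at L and ends at M. Indices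
  -- above n are irrelevant and get the value 0.
  have hG : ∀ i : ℕ, ∃ G : StrongDual ℝ B, i ≤ n → IsUnitNormAttaining G ∧
      ‖(L + (i / n : ℝ) • E) - ‖L + (i / n : ℝ) • E‖ • G‖ ≤ δ ∧ (i = 0 → G = L) ∧
        (i = n → G = M) := by
    intro i
    rcases eq_or_ne i 0 with rfl | hi0
    · refine ⟨L, fun _ => ⟨hL, ?_, fun _ => rfl, fun h => absurd h.symm hnat⟩⟩
      simp [hL.1, hδ0.le]
    rcases eq_or_ne i n with rfl | hin
    · refine ⟨M, fun _ => ⟨hM, ?_, fun h => absurd h hi0, fun _ => rfl⟩⟩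
      rw [div_self hn0.ne', hE]
      simp [hM.1, hδ0.le]
    by_cases hle : i ≤ n
    swap
    · exact ⟨0, fun h => absurd h hle⟩
    set N := L + (i / n : ℝ) • E with hN
    have hNpos : 0 < ‖N‖ := hκ0.trans_le (hκ _ ⟨by positivity, by
      rw [div_le_one hn0]; exact_mod_cast hle⟩)
    have hN1 : ‖‖N‖⁻¹ • N‖ = 1 := by rw [norm_smul, norm_inv, norm_norm, inv_mul_cancel₀ hNpos.ne']
    obtain ⟨G, hG, hGN⟩ := exists_isUnitNormAttaining_norm_sub_le hN1
      (show 0 < δ / ‖N‖ by positivity)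
    refine ⟨G, fun _ => ⟨hG, ?_, fun h => absurd h hi0, fun h => absurd h hin⟩⟩
    have h1 : N - ‖N‖ • G = ‖N‖ • (‖N‖⁻¹ • N - G) := by
      rw [smul_sub, smul_smul, mul_inv_cancel₀ hNpos.ne', one_smul]
    rw [h1, norm_smul, norm_norm]
    rwa [le_div_iff₀ hNpos, mul_comm] at hGN
  choose G hG using hG
  have key : ∀ i : ℕ, i ≤ n → ∃ h ∈ D, 0 < ‖h‖ ∧ ‖h‖ ≤ s ∧ G i h = ‖h‖ ∧
      κ * (s - ‖h‖) ≤ s * (1 / n * (E (‖h‖⁻¹ • h) - E (‖g‖⁻¹ • g)) + 3 * i * δ) := by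
    intro i
    induction i with
    | zero =>
      intro h0
      refine ⟨g, hg, hg0, le_rfl, ?_, by simp [hs]⟩
      rw [(hG 0 h0).2.2.1 rfl, hLg]
    | succ i ih =>
      intro hi
      obtain ⟨h, hhD, hh0, hhs, hGh, hloss⟩ := ih (by omega)
      obtain ⟨-, hGi, -, -⟩ := hG i (by omega)
      obtain ⟨hG'A, hGi', -, -⟩ := hG (i + 1) hi
      set u := ‖h‖⁻¹ • h with hu
      have hu1 : ‖u‖ = 1 := norm_inv_smul_self hh0
      have hGu : G i u = 1 := by
        rw [hu, map_smul, hGh, smul_eq_mul, inv_mul_cancel₀ hh0.ne']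
      have hNN : L + ((i + 1 : ℕ) / n : ℝ) • E = L + (i / n : ℝ) • E + (1 / n : ℝ) • E := by
        push_cast; rw [add_div]; module
      have hκ' : κ ≤ ‖L + (i / n : ℝ) • E + (1 / n : ℝ) • E‖ := by
        rw [← hNN]
        exact hκ _ ⟨by positivity, by rw [div_le_one hn0]; exact_mod_cast hi⟩
      rw [hNN] at hGi'
      have hstep : ∀ w : B, ‖w‖ = 1 → G (i + 1) w = 1 →
          κ * (1 - G (i + 1) u) ≤ 1 / n * (E w - E u) + 3 * δ := fun w hw hGw =>
        mul_one_sub_le_of_near hGi hGi' hG'A.1 hκ' hu1 hw hGu hGw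
      have hn1 : (1 : ℝ) ≤ n := by exact_mod_cast Nat.one_le_iff_ne_zero.2 hnat
      have hδn : δ ≤ 1 / n := by
        rw [hδ, sq]
        exact one_div_le_one_div_of_le hn0 (by nlinarith)
      -- A face move needs a positive value; 7/n < κ prevents a single step from losing all of the
      -- norm.
      have hpos : 0 < G (i + 1) u := by
        obtain ⟨w, hw, hGw⟩ := hG'A.2
        have h1 := hstep w hw hGw
        have h2 : E w - E u ≤ 4 := by
          linarith [(abs_le.1 (hEu w hw)).2, (abs_le.1 (hEu u hu1)).1]
        have h3 : 1 / (n : ℝ) * (E w - E u) ≤ 1 / n * 4 :=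
          mul_le_mul_of_nonneg_left h2 (by positivity)
        have h4 : (7 : ℝ) / n = 1 / n * 4 + 3 * (1 / n) := by ring
        by_contra! hneg
        nlinarith
      have hGh' : G (i + 1) h = ‖h‖ * G (i + 1) u := map_eq_norm_mul_map_unit _ hh0
      have hu_le : G (i + 1) u ≤ 1 := hu1 ▸ le_norm_of_norm_le_one hG'A.1.le u
      obtain ⟨h', hh'D, hh'n, hh'G⟩ := hD h hhD _ hG'A (by rw [hGh']; positivity)
      have hh'0 : 0 < ‖h'‖ := by rw [hh'n, hGh']; positivity
      refine ⟨h', hh'D, hh'0, ?_, by rw [hh'G, hh'n], ?_⟩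
      · rw [hh'n, hGh']; nlinarith
      · have h1 := hstep (‖h'‖⁻¹ • h') (norm_inv_smul_self hh'0) (by
          rw [map_smul, hh'G, ← hh'n, smul_eq_mul, inv_mul_cancel₀ hh'0.ne'])
        set σ' := E (‖h'‖⁻¹ • h')
        have h2 : 0 ≤ κ * (1 - G (i + 1) u) := mul_nonneg hκ0.le (by linarith)
        have h3 : ‖h‖ * (κ * (1 - G (i + 1) u)) ≤ s * (1 / n * (σ' - E u) + 3 * δ) :=
          mul_le_mul hhs h1 h2 hg0.le
        have h4 : κ * (s - ‖h'‖) = κ * (s - ‖h‖) + ‖h‖ * (κ * (1 - G (i + 1) u)) := by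
          rw [hh'n, hGh']; ring
        rw [h4]
        push_cast
        linarith
  obtain ⟨h, hhD, hh0, hhs, hGh, hloss⟩ := key n le_rfl
  refine ⟨h, hhD, ?_, hhs, by rw [← (hG n le_rfl).2.2.2 rfl, hGh]⟩
  have h1 : E (‖h‖⁻¹ • h) - E (‖g‖⁻¹ • g) ≤ 4 := by
    linarith [(abs_le.1 (hEu _ (norm_inv_smul_self hh0))).2,
      (abs_le.1 (hEu _ (norm_inv_smul_self hg0))).1]
  have h2 : 1 / (n : ℝ) * (E (‖h‖⁻¹ • h) - E (‖g‖⁻¹ • g)) ≤ 1 / n * 4 :=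
    mul_le_mul_of_nonneg_left h1 (by positivity)
  have h3 : 3 * (n : ℝ) * δ = 3 / n := by rw [hδ]; field_simp
  have h4 : 1 / (n : ℝ) * 4 + 3 / n = 7 / n := by ring
  have h5 : κ * (s - ‖h‖) < κ * (s - max t 0) := by
    refine (hloss.trans ?_).trans_lt hn'
    rw [mul_comm s]
    exact mul_le_mul_of_nonneg_right (by linarith) hg0.le
  have h6 := lt_of_mul_lt_mul_left h5 hκ0.le
  linarith [le_max_left t 0]

/-- In a face-closed set one can move to the face of any norm attaining functional with an
arbitrarily small loss of norm. -/
theorem IsFaceClosed.exists_rotate (hD : IsFaceClosed D) (hdim : 2 ≤ Module.rank ℝ B)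
    {M : StrongDual ℝ B} (hM : IsUnitNormAttaining M) {g : B} (hg : g ∈ D)
    (hg0 : 0 < ‖g‖) {t : ℝ} (ht : t < ‖g‖) :
    ∃ h ∈ D, t < ‖h‖ ∧ ‖h‖ ≤ ‖g‖ ∧ M h = ‖h‖ := by
  obtain ⟨L, hL1, hLg⟩ := exists_dual_vector ℝ g hg0.ne'
  have hattain : ∀ {K : StrongDual ℝ B} {x : B}, ‖K‖ = 1 → 0 < ‖x‖ → K x = ‖x‖ →
      IsUnitNormAttaining K := fun {K x} h1 h2 h3 => ⟨h1, ‖x‖⁻¹ • x, norm_inv_smul_self h2, by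
    rw [map_smul, h3, smul_eq_mul, inv_mul_cancel₀ h2.ne']⟩
  have hL : IsUnitNormAttaining L := hattain hL1 hg0 hLg
  -- The segment from L to −L passes through the origin, so the antipodal case detours through a
  -- functional norming a vector of ker L.
  by_cases hne : M = -L
  swap
  · exact hD.exists_rotate_of_ne_neg hL hM hne hg hg0 hLg ht
  obtain ⟨v, hv0, hv⟩ := exists_ne_zero_map_eq_zero hdim L
  obtain ⟨N, hN1, hNv⟩ := exists_dual_vector ℝ v (norm_ne_zero_iff.2 hv0)
  have hvpos := norm_pos_iff.2 hv0
  rw [RCLike.ofReal_real_eq_id, id] at hNv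
  have hN := hattain hN1 hvpos hNv
  have hNL : N ≠ -L := by
    rintro rfl
    rw [neg_apply, hv, neg_zero] at hNv
    exact hvpos.ne hNv
  have hMN : M ≠ -N := by
    rw [hne]
    intro h
    have h1 := congrArg (fun K : StrongDual ℝ B => K v) h
    simp only [neg_apply, hv, hNv, neg_zero] at h1
    linarith
  obtain ⟨h, hhD, hth, hhg, hNh⟩ := hD.exists_rotate_of_ne_neg hL hN hNL hg hg0 hLg
    (max_lt ht hg0)
  obtain ⟨h', hhD', hth', hhg', hMh'⟩ := hD.exists_rotate_of_ne_neg hN hM hMN hhD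
    ((le_max_right _ _).trans_lt hth) hNh ((le_max_left _ _).trans_lt hth)
  exact ⟨h', hhD', hth', hhg'.trans hhg, hMh'⟩

end

/-! ### Shrinking norms at corners -/

section

variable {B : Type*} [NormedAddCommGroup B] [NormedSpace ℝ B]

theorem norm_eq_one_of_norm_le_one {M : StrongDual ℝ B} (hM : ‖M‖ ≤ 1) {p : B} (hp : ‖p‖ = 1)
    (hMp : M p = 1) : ‖M‖ = 1 :=
  le_antisymm hM (hMp ▸ le_opNorm_of_norm_eq_one M hp)

theorem convexOn_norm_add_smul {V : Type*} [NormedAddCommGroup V] [NormedSpace ℝ V] (x v : V) :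
    ConvexOn ℝ Set.univ fun b : ℝ => ‖x + b • v‖ := by
  refine ⟨convex_univ, fun a _ b _ u w hu hw huw => ?_⟩
  have h1 : x + (u • a + w • b) • v = u • (x + a • v) + w • (x + b • v) := by
    have : u • (x + a • v) + w • (x + b • v) = (u + w) • x + (u • a + w • b) • v := by
      simp only [smul_eq_mul]; module
    rw [this, huw, one_smul]
  simp only [h1]
  refine (norm_add_le _ _).trans ?_
  rw [norm_smul, norm_smul, Real.norm_of_nonneg hu, Real.norm_of_nonneg hw]
  rfl

theorem lipschitzWith_norm_add_smul {V : Type*} [NormedAddCommGroup V] [NormedSpace ℝ V]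
    (x v : V) : LipschitzWith ‖v‖₊ fun b : ℝ => ‖x + b • v‖ := by
  refine LipschitzWith.of_dist_le_mul fun a b => ?_
  rw [Real.dist_eq]
  refine (abs_norm_sub_norm_le _ _).trans ?_
  have : x + a • v - (x + b • v) = (a - b) • v := by module
  rw [this, norm_smul, Real.dist_eq, Real.norm_eq_abs, mul_comm, coe_nnnorm]

theorem exists_mem_Ioo_hasDerivAt_norm_add_smul {V : Type*} [NormedAddCommGroup V]
    [NormedSpace ℝ V] (x v : V) {c d : ℝ} (hcd : c < d) :
    ∃ a ∈ Set.Ioo c d, ∃ s, HasDerivAt (fun b : ℝ => ‖x + b • v‖) s a := by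
  have h1 := (lipschitzWith_norm_add_smul x v).ae_differentiableAt_real
  have h2 : (MeasureTheory.volume (Set.Ioo c d)) ≠ 0 := by
    rw [Real.volume_Ioo]; simp [hcd]
  obtain ⟨a, ha, hd⟩ := (MeasureTheory.frequently_ae_mem_iff.2 h2).and_eventually h1 |>.exists
  exact ⟨a, ha, _, hd.hasDerivAt⟩

/-- Where the dual norm is differentiable along a line, almost norming points of the functional
evaluate the direction of the line close to the derivative. -/
theorem exists_abs_sub_lt_of_hasDerivAt {N E : StrongDual ℝ B} {a s : ℝ}
    (hs : HasDerivAt (fun b : ℝ => ‖N + b • E‖) s a) {κ : ℝ} (hκ : 0 < κ) :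
    ∃ δ > 0, ∀ u : B, ‖u‖ = 1 → ‖N + a • E‖ - δ ≤ N u + a * E u → |E u - s| < κ := by
  have h1 := (hasDerivAt_iff_isLittleO.1 hs).def (half_pos hκ)
  obtain ⟨η, hη, hball⟩ := Metric.eventually_nhds_iff.1 h1
  -- Testing the derivative at the increments ±η/2 bounds E u − s from both sides.
  have h2 : ∀ b : ℝ, |b| = η / 2 → ‖N + (a + b) • E‖ ≤ ‖N + a • E‖ + b * s + κ / 2 * (η / 2) := by
    intro b hb
    have h3 := hball (y := a + b) (by rw [Real.dist_eq, add_sub_cancel_left, hb]; linarith)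
    rw [add_sub_cancel_left, Real.norm_eq_abs, Real.norm_eq_abs, hb, smul_eq_mul] at h3
    linarith [(abs_le.1 h3).2]
  refine ⟨κ * η / 8, by positivity, fun u hu hNu => ?_⟩
  have h3 : ∀ b : ℝ, |b| = η / 2 → b * (E u - s) ≤ 3 / 4 * κ * (η / 2) := by
    intro b hb
    have h4 := (le_opNorm_of_norm_eq_one (N + (a + b) • E) hu).trans (h2 b hb)
    simp only [add_apply, smul_apply, smul_eq_mul] at h4
    linarith
  have h4 := h3 (η / 2) (abs_of_pos (by positivity))
  have h5 := h3 (-(η / 2)) (by rw [abs_neg]; exact abs_of_pos (by positivity))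
  rw [abs_lt]
  constructor <;> nlinarith

variable [CompleteSpace B] {D : Set B}

/-- Rotate to the face of a norm attaining G close to the normalised N₀ + aE. On its unit vectors E
is nearly s, so N₀ is at least about 1 − as and N₁ at most about 1 − s. Some proper convex
combination K therefore takes the value x‖g‖, and the face move for K lands where K attains its
norm, which happens only where both N₀ and N₁ do. -/
theorem IsFaceClosed.exists_shrink_of_hasDerivAt (hD : IsFaceClosed D)
    (hdim : 2 ≤ Module.rank ℝ B) {N₀ N₁ : StrongDual ℝ B} (hN₀ : ‖N₀‖ = 1) (hN₁ : ‖N₁‖ = 1)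
    {p : B} (hp : ‖p‖ = 1) (hN₀p : N₀ p = 1) (hN₁p : N₁ p = 1) {a s : ℝ} (ha : 0 < a)
    (ha1 : 1 < ‖N₀ + a • (N₀ - N₁)‖)
    (hs : HasDerivAt (fun b : ℝ => ‖N₀ + b • (N₀ - N₁)‖) s a) {x : ℝ} (hx : 0 < x)
    (hax : a * s < 1 - x) (hxs : 1 - x < s) {g : B} (hg : g ∈ D) (hg0 : 0 < ‖g‖) :
    ∃ h ∈ D, ‖h‖ = x * ‖g‖ ∧ N₀ h = ‖h‖ ∧ N₁ h = ‖h‖ := by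
  set E := N₀ - N₁ with hE
  obtain ⟨κ, hκ, hκ1, hκ2⟩ : ∃ κ > 0, a * (s + κ) < 1 - x ∧ 1 - x < s - κ := by
    refine ⟨min ((1 - x - a * s) / (2 * a)) ((s - (1 - x)) / 2),
      lt_min (div_pos (by linarith) (by linarith)) (by linarith), ?_, ?_⟩
    · have h1 := mul_le_mul_of_nonneg_left
        (min_le_left ((1 - x - a * s) / (2 * a)) ((s - (1 - x)) / 2)) ha.le
      have h2 : a * ((1 - x - a * s) / (2 * a)) = (1 - x - a * s) / 2 := by field_simp
      linarith
    · linarith [min_le_right ((1 - x - a * s) / (2 * a)) ((s - (1 - x)) / 2)]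
  obtain ⟨δ, hδ, hδu⟩ := exists_abs_sub_lt_of_hasDerivAt hs hκ
  set ψ := ‖N₀ + a • E‖ with hψ
  have hψ0 : 0 < ψ := by linarith
  -- Accuracy δ pins E u to s; accuracy ψ − 1 gives N₀ u + a E u ≥ 1.
  have hδ' : 0 < min δ (ψ - 1) := lt_min hδ (by linarith)
  obtain ⟨G, hG, hGN⟩ := exists_isUnitNormAttaining_norm_sub_le
    (L := ψ⁻¹ • (N₀ + a • E)) (by
      rw [norm_smul, norm_inv, Real.norm_of_nonneg hψ0.le, inv_mul_cancel₀ hψ0.ne'])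
    (show 0 < min δ (ψ - 1) / ψ by positivity)
  have hgt : x * ‖g‖ / (1 - a * (s + κ)) < ‖g‖ := by
    rw [div_lt_iff₀ (by linarith), mul_comm]
    exact mul_lt_mul_of_pos_left (by linarith) hg0
  obtain ⟨g', hg'D, hg'lt, hg'le, hGg'⟩ := hD.exists_rotate hdim hG hg hg0 hgt
  rw [div_lt_iff₀ (by linarith)] at hg'lt
  have hg'0 : 0 < ‖g'‖ := by
    have : 0 < ‖g'‖ * (1 - a * (s + κ)) := lt_trans (by positivity) hg'lt
    exact pos_of_mul_pos_left this (by linarith)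
  set u := ‖g'‖⁻¹ • g' with hu
  have hu1 : ‖u‖ = 1 := norm_inv_smul_self hg'0
  have hGu : G u = 1 := by rw [hu, map_smul, hGg', smul_eq_mul, inv_mul_cancel₀ hg'0.ne']
  have hNu : ψ - min δ (ψ - 1) ≤ N₀ u + a * E u := by
    have h1 := (le_opNorm_of_norm_eq_one _ hu1).trans
      ((norm_neg (ψ⁻¹ • (N₀ + a • E) - G)).le.trans hGN)
    simp only [neg_apply, sub_apply, smul_apply, add_apply, smul_eq_mul, hGu] at h1
    rw [le_div_iff₀ hψ0] at h1
    have h2 : ψ⁻¹ * (N₀ u + a * E u) * ψ = N₀ u + a * E u := by field_simp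
    linarith
  have hEu := abs_lt.1 (hδu u hu1 (by linarith [min_le_left δ (ψ - 1)]))
  have hNu1 : 1 ≤ N₀ u + a * E u := by linarith [min_le_right δ (ψ - 1)]
  have hN₀u : 1 - a * (s + κ) ≤ N₀ u := by
    linarith [mul_le_mul_of_nonneg_left (show E u ≤ s + κ by linarith) ha.le]
  have hN₁u : N₁ u < x := by
    have h1 : E u = N₀ u - N₁ u := by simp [hE]
    have h2 : N₀ u ≤ 1 := hu1 ▸ le_norm_of_norm_le_one hN₀.le u
    linarith
  have hA : x * ‖g‖ < N₀ g' := by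
    rw [map_eq_norm_mul_map_unit N₀ hg'0]
    exact hg'lt.trans_le (mul_le_mul_of_nonneg_left hN₀u hg'0.le)
  have hB : N₁ g' < x * ‖g‖ := by
    rw [map_eq_norm_mul_map_unit N₁ hg'0]
    have h1 := mul_lt_mul_of_pos_left hN₁u hg'0
    have h2 := mul_le_mul_of_nonneg_left hg'le hx.le
    linarith
  set τ := (N₀ g' - x * ‖g‖) / (N₀ g' - N₁ g') with hτ
  have hτ0 : 0 < τ := div_pos (by linarith) (by linarith)
  have hτ1 : τ < 1 := by rw [hτ, div_lt_one (by linarith)]; linarith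
  have hτg : (1 - τ) * N₀ g' + τ * N₁ g' = x * ‖g‖ := by
    have : τ * (N₀ g' - N₁ g') = N₀ g' - x * ‖g‖ := div_mul_cancel₀ _ (by linarith)
    linarith
  set K := (1 - τ) • N₀ + τ • N₁ with hK
  have hKp : K p = 1 := by simp [hK, hN₀p, hN₁p]
  have hK1 : ‖K‖ ≤ 1 := by
    refine (norm_add_le _ _).trans ?_
    rw [norm_smul, norm_smul, hN₀, hN₁, Real.norm_of_nonneg hτ0.le,
      Real.norm_of_nonneg (by linarith)]
    linarith
  have hKg : K g' = x * ‖g‖ := by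
    rw [← hτg]; simp [hK]
  obtain ⟨h, hhD, hhn, hKh⟩ := hD g' hg'D K
    ⟨norm_eq_one_of_norm_le_one hK1 hp hKp, p, hp, hKp⟩ (by rw [hKg]; positivity)
  rw [hKg] at hhn hKh
  have h0 := le_norm_of_norm_le_one hN₀.le h
  have h1 := le_norm_of_norm_le_one hN₁.le h
  have h2 : (1 - τ) * N₀ h + τ * N₁ h = ‖h‖ := by rw [hhn, ← hKh]; simp [hK]
  refine ⟨h, hhD, hhn, le_antisymm h0 ?_, le_antisymm h1 ?_⟩
  · refine le_of_mul_le_mul_left (a := 1 - τ) ?_ (by linarith)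
    linarith [mul_le_mul_of_nonneg_left h1 hτ0.le]
  · refine le_of_mul_le_mul_left (a := τ) ?_ hτ0
    linarith [mul_le_mul_of_nonneg_left h0 (sub_nonneg.2 hτ1.le)]

/-- At a corner with extreme supporting functional `N₀`, norms can be shrunk by any factor. -/
theorem IsFaceClosed.exists_shrink_of_extreme (hD : IsFaceClosed D)
    (hdim : 2 ≤ Module.rank ℝ B) {N₀ N₁ : StrongDual ℝ B} (hN₀ : ‖N₀‖ = 1) (hN₁ : ‖N₁‖ = 1)
    {p : B} (hp : ‖p‖ = 1) (hN₀p : N₀ p = 1) (hN₁p : N₁ p = 1)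
    (hext : ∀ a : ℝ, 0 < a → 1 < ‖N₀ + a • (N₀ - N₁)‖) {x : ℝ} (hx0 : 0 < x) (hx1 : x < 1)
    {g : B} (hg : g ∈ D) (hg0 : 0 < ‖g‖) :
    ∃ h ∈ D, ‖h‖ = x * ‖g‖ ∧ N₀ h = ‖h‖ ∧ N₁ h = ‖h‖ := by
  -- The dual norm along the line is Lipschitz, so differentiability points exist arbitrarily near
  -- 0. As s ≤ 2, this range gives as < 1 − x; it also gives a < 1/4, which preserves that condition
  -- when x is replaced by √x below.
  obtain ⟨a, ⟨ha0, ha4⟩, s, hs⟩ := exists_mem_Ioo_hasDerivAt_norm_add_smul N₀ (N₀ - N₁)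
    (show 0 < (1 - x) / 4 by linarith)
  have hconv := convexOn_norm_add_smul N₀ (N₀ - N₁)
  have hs0 : 0 < s := by
    have h1 := hconv.slope_le_of_hasDerivAt (Set.mem_univ 0) (Set.mem_univ a) ha0 hs
    refine lt_of_lt_of_le ?_ h1
    rw [slope_def_field]
    refine div_pos ?_ (by linarith)
    simpa [hN₀] using hext a ha0
  have hs2 : s ≤ 2 := by
    have h1 := hs.le_of_lipschitz (lipschitzWith_norm_add_smul N₀ (N₀ - N₁))
    rw [Real.norm_eq_abs, coe_nnnorm] at h1
    have h2 := norm_sub_le N₀ N₁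
    linarith [le_abs_self s]
  -- A factor too small for one step is achieved as √x · √x; repeated square roots tend to 1 and
  -- eventually exceed 1 − s.
  have main : ∀ k : ℕ, ∀ x : ℝ, 0 < x → a * s < 1 - x → 1 - x ^ ((1 / 2 : ℝ) ^ k) < s →
      ∀ g ∈ D, 0 < ‖g‖ → ∃ h ∈ D, ‖h‖ = x * ‖g‖ ∧ N₀ h = ‖h‖ ∧ N₁ h = ‖h‖ := by
    intro k
    induction k with
    | zero =>
      intro x hx hax hxs g hg hg0
      rw [pow_zero, Real.rpow_one] at hxs
      exact hD.exists_shrink_of_hasDerivAt hdim hN₀ hN₁ hp hN₀p hN₁p ha0 (hext a ha0) hs hx hax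
        hxs hg hg0
    | succ k ih =>
      intro x hx hax hxs g hg hg0
      by_cases hlt : 1 - x < s
      · exact hD.exists_shrink_of_hasDerivAt hdim hN₀ hN₁ hp hN₀p hN₁p ha0 (hext a ha0) hs hx hax
          hlt hg hg0
      have hy0 : 0 < √x := Real.sqrt_pos.2 hx
      have hyy : √x * √x = x := Real.mul_self_sqrt hx.le
      have hy1 : √x < 1 := by
        rw [Real.sqrt_lt' one_pos]
        nlinarith [mul_pos ha0 hs0]
      have h1 : a * s < 1 - √x := by nlinarith
      have h2 : 1 - √x ^ ((1 / 2 : ℝ) ^ k) < s := by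
        rwa [Real.sqrt_eq_rpow, ← Real.rpow_mul hx.le, ← pow_succ']
      obtain ⟨h, hhD, hhn, -, -⟩ := ih _ hy0 h1 h2 g hg hg0
      obtain ⟨h', hh'D, hh'n, hh'⟩ := ih _ hy0 h1 h2 h hhD (by rw [hhn]; positivity)
      exact ⟨h', hh'D, by rw [hh'n, hhn, ← mul_assoc, hyy], hh'⟩
  have hlim : Filter.Tendsto (fun k : ℕ => x ^ ((1 / 2 : ℝ) ^ k)) Filter.atTop (nhds 1) := by
    have h1 := (Real.continuousAt_const_rpow (b := 0) hx0.ne').tendsto.comp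
      (tendsto_pow_atTop_nhds_zero_of_lt_one (r := (1 / 2 : ℝ)) (by norm_num) (by norm_num))
    rwa [Real.rpow_zero] at h1
  obtain ⟨k, hk⟩ := (hlim.eventually (lt_mem_nhds (show 1 - s < 1 by linarith))).exists
  exact main k x hx0 (by nlinarith) (by linarith) g hg hg0

/-- If the unit sphere has a corner at `p`, with supporting functionals `M₁ ≠ M₂`, then a
face-closed set that contains a point `g` meets the common face of `M₁` and `M₂` in every ball of
smaller radius. -/
theorem IsFaceClosed.exists_mem_corner (hD : IsFaceClosed D)
    (hdim : 2 ≤ Module.rank ℝ B) {M₁ M₂ : StrongDual ℝ B} (hM₁ : ‖M₁‖ = 1) (hM₂ : ‖M₂‖ = 1)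
    (hne : M₁ ≠ M₂) {p : B} (hp : ‖p‖ = 1) (hM₁p : M₁ p = 1) (hM₂p : M₂ p = 1) {ρ : ℝ}
    (hρ : 0 < ρ) {g : B} (hg : g ∈ D) (hρg : ρ < ‖g‖) :
    ∃ h ∈ D, ‖h‖ = ρ ∧ M₁ h = ρ ∧ M₂ h = ρ := by
  set F := M₂ - M₁ with hF
  have hFpos : 0 < ‖F‖ := norm_pos_iff.2 (sub_ne_zero.2 hne.symm)
  set S : Set ℝ := {θ | ‖M₁ + θ • F‖ ≤ 1} with hS
  have hS0 : (0 : ℝ) ∈ S := by simp [hS, hM₁]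
  have hS1 : (1 : ℝ) ∈ S := by simp [hS, hF, hM₂]
  have hSb : BddBelow S := by
    refine ⟨-(2 / ‖F‖), fun θ hθ => ?_⟩
    have h1 : ‖θ • F‖ ≤ 2 := by
      have : θ • F = (M₁ + θ • F) - M₁ := by abel
      rw [this]
      refine (norm_sub_le _ _).trans ?_
      rw [hM₁]
      have : ‖M₁ + θ • F‖ ≤ 1 := hθ
      linarith
    rw [norm_smul, ← le_div_iff₀ hFpos] at h1
    exact (abs_le.1 h1).1
  have hSc : IsClosed S := isClosed_le (by fun_prop) continuous_const
  -- The least parameter gives the extreme functional. Its partner at α + 1 remains in S because α ≤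
  -- 0 and 1 ∈ S.
  set α := sInf S with hα
  have hαS : α ∈ S := hSc.csInf_mem ⟨0, hS0⟩ hSb
  have hα0 : α ≤ 0 := csInf_le hSb hS0
  have hα1 : α + 1 ∈ S := by
    have hconv : Convex ℝ S := by
      have := (convexOn_norm_add_smul M₁ F).convex_le 1
      simpa [hS] using this
    exact hconv.ordConnected.out hαS hS1 ⟨by linarith, by linarith⟩
  have hFp : F p = 0 := by simp [hF, hM₁p, hM₂p]
  have hp' : ∀ θ : ℝ, (M₁ + θ • F) p = 1 := fun θ => by simp [hFp, hM₁p]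
  have hsub : ∀ a : ℝ, (M₁ + α • F) + a • ((M₁ + α • F) - (M₁ + (α + 1) • F)) =
      M₁ + (α - a) • F := fun a => by module
  obtain ⟨h, hhD, hhn, h0, h1⟩ := hD.exists_shrink_of_extreme hdim
    (norm_eq_one_of_norm_le_one hαS hp (hp' _)) (norm_eq_one_of_norm_le_one hα1 hp (hp' _)) hp
    (hp' _) (hp' _) (fun a ha => by
      rw [hsub]
      by_contra! hle
      have : α ≤ α - a := csInf_le hSb hle
      linarith) (div_pos hρ (hρ.trans hρg)) ((div_lt_one (hρ.trans hρg)).2 hρg) hg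
    (hρ.trans hρg)
  rw [div_mul_cancel₀ _ (hρ.trans hρg).ne'] at hhn
  rw [hhn] at h0 h1
  simp only [add_apply, smul_apply, smul_eq_mul] at h0 h1
  have hFh : F h = 0 := by linarith
  have hM₁h : M₁ h = ρ := by rw [hFh] at h0; linarith
  refine ⟨h, hhD, hhn, hM₁h, ?_⟩
  have : F h = M₂ h - M₁ h := by simp [hF]
  linarith

end

/-! ### Convex functions of one real variable -/

/-- A real interval that is countable has at most one point. -/
theorem Set.Countable.subsingleton_of_ordConnected {s : Set ℝ} (hs : s.Countable)
    (hc : s.OrdConnected) : s.Subsingleton := by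
  have aux : ∀ a ∈ s, ∀ b ∈ s, ¬ a < b := fun a ha b hb hab =>
    Cardinal.Real.Ioo_countable_iff.1 (hs.mono (Set.Ioo_subset_Icc_self.trans (hc.out ha hb)))
      |>.not_gt hab
  intro a ha b hb
  exact le_antisymm (not_lt.1 (aux b hb a ha)) (not_lt.1 (aux a ha b hb))

/-- A convex function with only one subgradient at a point is differentiable there. -/
theorem ConvexOn.exists_hasDerivAt_of_unique_subgradient {φ : ℝ → ℝ}
    (hφ : ConvexOn ℝ Set.univ φ) {x : ℝ}
    (huniq : ∀ σ₁ σ₂ : ℝ, (∀ y, φ x + σ₁ * (y - x) ≤ φ y) → (∀ y, φ x + σ₂ * (y - x) ≤ φ y) →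
      σ₁ = σ₂) :
    ∃ σ, HasDerivAt φ σ x ∧ ∀ y, φ x + σ * (y - x) ≤ φ y := by
  have hx : x ∈ interior (Set.univ : Set ℝ) := by simp
  have hlr := hφ.leftDeriv_le_rightDeriv_of_mem_interior hx
  have hr := hφ.hasDerivWithinAt_rightDeriv_of_mem_interior hx
  have hl := hφ.hasDerivWithinAt_leftDeriv_of_mem_interior hx
  have hsub : ∀ σ, derivWithin φ (Set.Iio x) x ≤ σ → σ ≤ derivWithin φ (Set.Ioi x) x →
      ∀ y, φ x + σ * (y - x) ≤ φ y := by
    intro σ h1 h2 y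
    rcases lt_trichotomy x y with hxy | rfl | hxy
    · have h3 := hφ.rightDeriv_le_slope_of_mem_interior hx (Set.mem_univ y) hxy
      rw [slope_def_field, le_div_iff₀ (by linarith)] at h3
      nlinarith
    · simp
    · have h3 := hφ.slope_le_leftDeriv_of_mem_interior (Set.mem_univ y) hx hxy
      rw [slope_def_field, div_le_iff₀ (by linarith)] at h3
      nlinarith
  have heq := huniq _ _ (hsub _ le_rfl hlr) (hsub _ hlr le_rfl)
  refine ⟨_, ?_, hsub _ hlr le_rfl⟩
  rw [heq] at hl
  have := hl.Iic_of_Iio.union hr.Ici_of_Ioi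
  rwa [Set.Iic_union_Ici, hasDerivWithinAt_univ] at this

/-- A convex function that is differentiable on an open interval and near no point of it strictly
convex on both sides is affine on that interval. -/
theorem ConvexOn.deriv_eq_of_forall_exists_affine {φ : ℝ → ℝ} (hφ : ConvexOn ℝ Set.univ φ)
    {U : Set ℝ} (hU : IsOpen U) (hUc : U.OrdConnected)
    (hd : ∀ x ∈ U, DifferentiableAt ℝ φ x)
    (haff : ∀ x ∈ U, ∃ σ, (∀ y, φ x + σ * (y - x) ≤ φ y) ∧
      ∃ y, y ≠ x ∧ φ y = φ x + σ * (y - x)) {x y : ℝ} (hx : x ∈ U) (hy : y ∈ U) :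
    deriv φ x = deriv φ y := by
  have hline : ∀ x z σ : ℝ, DifferentiableAt ℝ φ z → φ z = φ x + σ * (z - x) →
      (∀ y, φ x + σ * (y - x) ≤ φ y) → deriv φ z = σ := by
    intro x z σ hz hzx hle
    have hmin : IsLocalMin (fun y => φ y - σ * y) z := Filter.Eventually.of_forall fun y => by
      simp only
      linarith [hle y]
    have h1 : HasDerivAt (fun y => φ y - σ * y) (deriv φ z - σ) z := by
      have := hz.hasDerivAt.sub ((hasDerivAt_id z).const_mul σ)
      rwa [mul_one] at this
    linarith [hmin.hasDerivAt_eq_zero h1]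
  -- Each value of the derivative is attained on a whole touching segment near the point, so the
  -- level sets have nonempty, pairwise disjoint interiors. The values also form an interval by
  -- Darboux, hence there is only one.
  have hcount : (deriv φ '' U).Countable := by
    refine Set.PairwiseDisjoint.countable_of_isOpen
      (s := fun c => interior {z | z ∈ U ∧ deriv φ z = c}) ?_ (fun _ _ => isOpen_interior) ?_
    · intro c _ d _ hcd
      refine Set.disjoint_left.2 fun z hz hz' => hcd ?_
      rw [← (interior_subset hz).2, ← (interior_subset hz').2]
    · rintro _ ⟨x, hx, rfl⟩
      obtain ⟨σ, hσ, y, hyx, hy⟩ := haff x hx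
      have hxσ : deriv φ x = σ := hline x x σ (hd x hx) (by simp) hσ
      set W : Set ℝ := Set.Ioo (min x y) (max x y) with hW
      have hWU : (W ∩ U).Nonempty := by
        have hxW : x ∈ closure W := by
          rw [hW, closure_Ioo (by rcases lt_or_gt_of_ne hyx with h | h <;> simp [h.ne, h.le])]
          exact ⟨min_le_left _ _, le_max_left _ _⟩
        rw [Set.inter_comm]
        exact mem_closure_iff.1 hxW U hU hx
      refine hWU.mono (interior_maximal ?_ (isOpen_Ioo.inter hU))
      rintro z ⟨hzW, hzU⟩
      refine ⟨hzU, ?_⟩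
      rw [hxσ]
      refine hline x z σ (hd z hzU) (le_antisymm ?_ (hσ z)) hσ
      obtain ⟨a, b, ha, hb, hab, rfl⟩ : z ∈ segment ℝ x y := by
        rw [segment_eq_uIcc]; exact Set.Ioo_subset_Icc_self hzW
      have h1 := hφ.2 (Set.mem_univ x) (Set.mem_univ y) ha hb hab
      rw [hy] at h1
      simp only [smul_eq_mul] at h1 ⊢
      have ha' : a = 1 - b := by linarith
      subst ha'
      linarith
  have hoc : (deriv φ '' U).OrdConnected :=
    hUc.image_deriv hd
  exact hcount.subsingleton_of_ordConnected hoc ⟨x, hx, rfl⟩ ⟨y, hy, rfl⟩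

/-! ### Corners from non-rotundity -/

section

variable {B : Type*} [NormedAddCommGroup B] [NormedSpace ℝ B]

/-- Non-rotundity provides segments in the unit sphere in every two-dimensional direction. -/
theorem UniformlyNonRotund.exists_segment (hB : UniformlyNonRotund B) {p v : B} (hp : ‖p‖ = 1)
    (hpv : LinearIndependent ℝ ![p, v]) :
    ∃ (α β : ℝ) (M : StrongDual ℝ B), β ≠ 0 ∧ ‖α • p + β • v‖ = 1 ∧ ‖M‖ = 1 ∧ M p = 1 ∧
      M (α • p + β • v) = 1 := by
  have hfin : Module.finrank ℝ (Submodule.span ℝ (Set.range ![p, v])) = 2 := by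
    rw [finrank_span_eq_card hpv, Fintype.card_fin]
  have hpX : p ∈ Submodule.span ℝ (Set.range ![p, v]) := Submodule.subset_span ⟨0, rfl⟩
  have hnr := (hB p (norm_ne_zero_iff.1 (by rw [hp]; exact one_ne_zero))).2 _ hfin hpX
  unfold IsRotundPoint at hnr
  push Not at hnr
  obtain ⟨⟨y, hyX⟩, hy1, hy2, hne⟩ := hnr
  simp only [Submodule.coe_norm, Submodule.coe_smul, Submodule.coe_add] at hy1 hy2
  rw [hp] at hy1
  rw [hy1] at hy2
  have hyp : p ≠ y := fun h => hne (Subtype.ext h)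
  have hrange : Set.range ![p, v] = {p, v} := by
    simp [Matrix.range_cons, Set.pair_comm]
  rw [hrange, Submodule.mem_span_pair] at hyX
  obtain ⟨α, β, rfl⟩ := hyX
  -- A functional norming the midpoint must equal 1 at both ends, since neither value can exceed 1.
  obtain ⟨M, hM, hMm⟩ := exists_dual_vector ℝ ((1 / 2 : ℝ) • (p + (α • p + β • v)))
    (by rw [← hy2]; exact one_ne_zero)
  rw [RCLike.ofReal_real_eq_id, id, ← hy2] at hMm
  have h1 := le_norm_of_norm_le_one hM.le p
  have h2 := le_norm_of_norm_le_one hM.le (α • p + β • v)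
  rw [hp] at h1
  rw [hy1] at h2
  rw [map_smul, map_add, smul_eq_mul] at hMm
  refine ⟨α, β, M, ?_, hy1, hM, by linarith, by linarith⟩
  rintro rfl
  rw [zero_smul, add_zero] at h2 hMm hy1 hyp
  rw [map_smul, smul_eq_mul] at hMm h2
  have hMp : M p = 1 := by linarith [h1, h2]
  have hα : α = 1 := by rw [hMp] at hMm; linarith
  exact hyp (by rw [hα, one_smul])

/-- If the kernel of a norm attaining functional `L` has dimension at least two, then the face of
`L` contains a corner of the unit sphere. -/
theorem UniformlyNonRotund.exists_corner_of_kernel (hB : UniformlyNonRotund B)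
    {L : StrongDual ℝ B} (hL : ‖L‖ = 1) {f : B} (hf : ‖f‖ = 1) (hLf : L f = 1) {v w : B}
    (hv : L v = 0) (hw : L w = 0) (hvw : LinearIndependent ℝ ![v, w]) :
    ∃ (p : B) (M : StrongDual ℝ B), ‖p‖ = 1 ∧ L p = 1 ∧ ‖M‖ = 1 ∧ M p = 1 ∧ M ≠ L := by
  have hvw0 := LinearIndependent.pair_iff.1 hvw
  set T : ℝ × ℝ →ₗ[ℝ] B :=
    (LinearMap.fst ℝ ℝ ℝ).smulRight v + (LinearMap.snd ℝ ℝ ℝ).smulRight w with hT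
  have hTapp : ∀ z, T z = z.1 • v + z.2 • w := fun z => by simp [hT]
  have hTker : LinearMap.ker T = ⊥ := by
    refine LinearMap.ker_eq_bot'.2 fun z hz => ?_
    rw [hTapp] at hz
    exact Prod.ext (hvw0 _ _ hz).1 (hvw0 _ _ hz).2
  obtain ⟨c, hc, hanti⟩ := T.exists_antilipschitzWith hTker
  set K : Set (ℝ × ℝ) := {z | ‖f + (z.1 • v + z.2 • w)‖ ≤ 1} with hK
  have hKclosed : IsClosed K := isClosed_le (by fun_prop) continuous_const
  have hKbdd : K ⊆ Metric.closedBall 0 (c * 2) := by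
    intro z hz
    have h1 := hanti.le_mul_dist z 0
    rw [map_zero, dist_zero_right, dist_zero_right, hTapp] at h1
    rw [mem_closedBall_zero_iff]
    refine h1.trans (mul_le_mul_of_nonneg_left ?_ c.2)
    have h2 : z.1 • v + z.2 • w = (f + (z.1 • v + z.2 • w)) - f := by abel
    have h3 : ‖f + (z.1 • v + z.2 • w)‖ ≤ 1 := hz
    rw [h2]
    refine (norm_sub_le _ _).trans ?_
    linarith
  have hKc : IsCompact K := (isCompact_closedBall _ _).of_isClosed_subset hKclosed hKbdd
  have hK0 : (0, 0) ∈ K := by simp [hK, hf]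
  -- Take the point of this compact slice of the face farthest from f in Euclidean coordinates.
  -- Moving orthogonally to its position vector would increase the distance, so a segment of the
  -- sphere at p in the plane of p and q cannot lie in the face of L.
  obtain ⟨⟨x, y⟩, hxyK, hmax⟩ := hKc.exists_isMaxOn ⟨_, hK0⟩
    (f := fun z : ℝ × ℝ => z.1 ^ 2 + z.2 ^ 2) (by fun_prop)
  set p := f + (x • v + y • w) with hp
  have hLp : L p = 1 := by simp [hp, hLf, hv, hw]
  have hp1 : ‖p‖ = 1 := le_antisymm hxyK (hLp ▸ le_norm_of_norm_le_one hL.le p)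
  obtain ⟨d, e, hde, horth⟩ : ∃ d e : ℝ, 0 < d ^ 2 + e ^ 2 ∧ x * d + y * e = 0 := by
    by_cases h : x = 0 ∧ y = 0
    · exact ⟨1, 0, by norm_num, by simp [h.1]⟩
    · refine ⟨-y, x, ?_, by ring⟩
      rcases not_and_or.1 h with h | h
      · have := sq_pos_of_ne_zero h; positivity
      · have : 0 < (-y) ^ 2 := by rw [neg_sq]; exact sq_pos_of_ne_zero h
        positivity
  set q := d • v + e • w with hq
  have hLq : L q = 0 := by simp [hq, hv, hw]
  have hq0 : ∀ b : ℝ, b • q = 0 → b = 0 := by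
    intro b hb
    have h1 := hvw0 (b * d) (b * e) (by rw [← hb, hq]; module)
    by_contra hb0
    have hd := (mul_eq_zero.1 h1.1).resolve_left hb0
    have he := (mul_eq_zero.1 h1.2).resolve_left hb0
    simp [hd, he] at hde
  have hpq : LinearIndependent ℝ ![p, q] := by
    refine LinearIndependent.pair_iff.2 fun a b hab => ?_
    have h1 := congrArg L hab
    simp only [map_add, map_smul, smul_eq_mul, hLp, hLq, map_zero, mul_one, mul_zero,
      add_zero] at h1
    subst h1
    exact ⟨rfl, hq0 b (by simpa using hab)⟩
  obtain ⟨α, β, M, hβ, hy1, hM, hMp, hMy⟩ := hB.exists_segment hp1 hpq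
  refine ⟨p, M, hp1, hLp, hM, hMp, ?_⟩
  rintro rfl
  have hα : α = 1 := by simpa [hLp, hLq] using hMy
  have hmem : (x + β * d, y + β * e) ∈ K := by
    have : f + ((x + β * d) • v + (y + β * e) • w) = α • p + β • q := by
      rw [hα, hp, hq]; module
    simp only [hK, Set.mem_ofPred_eq, this, hy1, le_refl]
  have h1 : (x + β * d) ^ 2 + (y + β * e) ^ 2 ≤ x ^ 2 + y ^ 2 := hmax hmem
  have h2 : 0 < β ^ 2 := by positivity
  have h3 : (x + β * d) ^ 2 + (y + β * e) ^ 2 =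
      x ^ 2 + y ^ 2 + 2 * β * (x * d + y * e) + β ^ 2 * (d ^ 2 + e ^ 2) := by ring
  rw [h3, horth] at h1
  linarith [mul_pos h2 hde]

end

section

variable {B : Type*} [NormedAddCommGroup B] [NormedSpace ℝ B]

/-- In the plane, a subgradient of the norm along a line gives a norming functional. -/
theorem exists_norming_of_subgradient {L c : StrongDual ℝ B} {f v : B} (hLf : L f = 1)
    (hLv : L v = 0) (hcf : c f = 0) (hcv : c v = 1) (hspan : ∀ x : B, x = L x • f + c x • v)
    {τ σ : ℝ} (hσ : ∀ y : ℝ, ‖f + τ • v‖ + σ * (y - τ) ≤ ‖f + y • v‖) :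
    ∃ M : StrongDual ℝ B, ‖M‖ ≤ 1 ∧ M (f + τ • v) = ‖f + τ • v‖ ∧ M v = σ := by
  set r := ‖f + τ • v‖ with hr
  have htri : ∀ y : ℝ, ‖f + y • v‖ ≤ r + |y - τ| * ‖v‖ := by
    intro y
    have : f + y • v = (f + τ • v) + (y - τ) • v := by module
    rw [this, hr, ← Real.norm_eq_abs, ← norm_smul]
    exact norm_add_le _ _
  have htri' : ∀ y : ℝ, |y - τ| * ‖v‖ ≤ ‖f + y • v‖ + r := by
    intro y
    have : (y - τ) • v = (f + y • v) - (f + τ • v) := by module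
    rw [hr, ← Real.norm_eq_abs, ← norm_smul, this]
    exact norm_sub_le _ _
  have hσv : |σ| ≤ ‖v‖ := by
    have h1 := (hσ (τ + 1)).trans (htri (τ + 1))
    have h2 := (hσ (τ - 1)).trans (htri (τ - 1))
    have e1 : τ + 1 - τ = 1 := by ring
    have e2 : τ - 1 - τ = -1 := by ring
    rw [e1, abs_one] at h1
    rw [e2, abs_neg, abs_one] at h2
    rw [abs_le]
    constructor <;> linarith
  have hσb : ∀ b : ℝ, b * σ ≤ |b| * ‖v‖ := fun b => by
    refine (le_abs_self _).trans ?_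
    rw [abs_mul]
    exact mul_le_mul_of_nonneg_left hσv (abs_nonneg b)
  -- The coefficients are forced by M v = σ and M (f + τ • v) = r.
  set M : StrongDual ℝ B := (r - τ * σ) • L + σ • c with hM
  have hMx : ∀ x, M x = (r - τ * σ) * L x + σ * c x := fun x => by simp [hM]
  -- The upper bound is the subgradient inequality; the lower one follows from |σ| ≤ ‖v‖ and the
  -- triangle inequality.
  have hMpos : ∀ a y : ℝ, 0 < a → |M (a • (f + y • v))| ≤ ‖a • (f + y • v)‖ := by
    intro a y ha
    have h1 : M (a • (f + y • v)) = a * (r + σ * (y - τ)) := by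
      simp only [map_smul, map_add, hMx, hLf, hLv, hcf, hcv, smul_eq_mul]; ring
    rw [h1, norm_smul, Real.norm_of_nonneg ha.le, abs_mul, abs_of_pos ha]
    refine mul_le_mul_of_nonneg_left (abs_le.2 ⟨?_, hσ y⟩) ha.le
    have h2 := htri' y
    have h3 := hσb (-(y - τ))
    rw [abs_neg] at h3
    linarith
  refine ⟨M, ContinuousLinearMap.opNorm_le_bound _ zero_le_one fun x => ?_, ?_, ?_⟩
  · rw [Real.norm_eq_abs, one_mul]
    have hx := hspan x
    rcases lt_trichotomy (L x) 0 with h | h | h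
    · have h1 : -x = (-L x) • (f + (c x / L x) • v) := by
        rw [smul_add, smul_smul, neg_mul, mul_div_cancel₀ _ h.ne]
        nth_rw 1 [hx]; module
      have h2 := hMpos (-L x) (c x / L x) (by linarith)
      rwa [← h1, map_neg, abs_neg, norm_neg] at h2
    · rw [h, zero_smul, zero_add] at hx
      rw [hMx, h, mul_zero, zero_add]
      nth_rw 2 [hx]
      rw [norm_smul, Real.norm_eq_abs, abs_mul, mul_comm]
      exact mul_le_mul_of_nonneg_left hσv (abs_nonneg _)
    · have h1 : x = L x • (f + (c x / L x) • v) := by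
        rw [smul_add, smul_smul, mul_div_cancel₀ _ h.ne']
        exact hx
      have h2 := hMpos (L x) (c x / L x) h
      rwa [← h1] at h2
  · simp only [map_add, map_smul, hMx, hLf, hLv, hcf, hcv, smul_eq_mul]; ring
  · simp [hMx, hLv, hcv]

/-- In a uniformly non-rotund plane there are corners of the unit sphere arbitrarily close to
every face. -/
theorem UniformlyNonRotund.exists_corner_of_plane (hB : UniformlyNonRotund B)
    {L c : StrongDual ℝ B} (hL : ‖L‖ = 1) {f v : B} (hf : ‖f‖ = 1) (hLf : L f = 1)
    (hLv : L v = 0) (hcf : c f = 0) (hcv : c v = 1) (hspan : ∀ x : B, x = L x • f + c x • v)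
    {b : ℝ} (hb0 : 0 < b) (hb1 : b < 1) :
    ∃ (p : B) (M₁ M₂ : StrongDual ℝ B), ‖p‖ = 1 ∧ b < L p ∧ ‖M₁‖ = 1 ∧ ‖M₂‖ = 1 ∧ M₁ ≠ M₂ ∧
      M₁ p = 1 ∧ M₂ p = 1 := by
  by_contra! hcon
  set φ : ℝ → ℝ := fun τ => ‖f + τ • v‖ with hφ
  have hφconv : ConvexOn ℝ Set.univ φ := convexOn_norm_add_smul f v
  have hLτ : ∀ τ : ℝ, L (f + τ • v) = 1 := fun τ => by simp [hLf, hLv]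
  have hφ1 : ∀ τ, 1 ≤ φ τ := fun τ => hLτ τ ▸ le_norm_of_norm_le_one hL.le _
  set U : Set ℝ := {τ | φ τ < 1 / b} with hU
  have hUo : IsOpen U := isOpen_lt (by fun_prop) continuous_const
  have hUc : Convex ℝ U := by simpa [hU] using hφconv.convex_lt (1 / b)
  have h0U : (0 : ℝ) ∈ U := by
    simp only [hU, hφ, Set.mem_ofPred_eq, zero_smul, add_zero, hf]
    rwa [lt_div_iff₀ hb0, one_mul]
  have hunit : ∀ τ : ℝ, ‖(φ τ)⁻¹ • (f + τ • v)‖ = 1 := fun τ =>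
    norm_inv_smul_self (one_pos.trans_le (hφ1 τ))
  have hφ0 : ∀ τ, φ τ ≠ 0 := fun τ => (one_pos.trans_le (hφ1 τ)).ne'
  -- Normalising f + τ • v gives L-value 1/φ τ, so U is exactly where the assumed absence of corners
  -- applies.
  have hsmooth : ∀ τ ∈ U, ∀ M₁ M₂ : StrongDual ℝ B, ‖M₁‖ ≤ 1 → ‖M₂‖ ≤ 1 →
      M₁ (f + τ • v) = φ τ → M₂ (f + τ • v) = φ τ → M₁ = M₂ := by
    intro τ hτ M₁ M₂ h1 h2 h3 h4
    have hM₁ : M₁ ((φ τ)⁻¹ • (f + τ • v)) = 1 := by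
      rw [map_smul, h3, smul_eq_mul, inv_mul_cancel₀ (hφ0 τ)]
    have hM₂ : M₂ ((φ τ)⁻¹ • (f + τ • v)) = 1 := by
      rw [map_smul, h4, smul_eq_mul, inv_mul_cancel₀ (hφ0 τ)]
    by_contra hne
    refine hcon _ M₁ M₂ (hunit τ) ?_ (norm_eq_one_of_norm_le_one h1 (hunit τ) hM₁)
      (norm_eq_one_of_norm_le_one h2 (hunit τ) hM₂) hne hM₁ hM₂
    rw [map_smul, hLτ, smul_eq_mul, mul_one, ← one_div, lt_one_div hb0
      (one_pos.trans_le (hφ1 τ))]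
    exact hτ
  have hd : ∀ τ ∈ U, ∃ σ, HasDerivAt φ σ τ ∧ ∀ y, φ τ + σ * (y - τ) ≤ φ y := by
    intro τ hτ
    refine hφconv.exists_hasDerivAt_of_unique_subgradient fun σ₁ σ₂ h1 h2 => ?_
    obtain ⟨M₁, hM₁, hM₁τ, rfl⟩ := exists_norming_of_subgradient hLf hLv hcf hcv hspan h1
    obtain ⟨M₂, hM₂, hM₂τ, rfl⟩ := exists_norming_of_subgradient hLf hLv hcf hcv hspan h2
    rw [hsmooth τ hτ M₁ M₂ hM₁ hM₂ hM₁τ hM₂τ]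
  have haff : ∀ τ ∈ U, ∃ σ, (∀ y, φ τ + σ * (y - τ) ≤ φ y) ∧
      ∃ y, y ≠ τ ∧ φ y = φ τ + σ * (y - τ) := by
    intro τ _
    obtain ⟨p, hp⟩ : ∃ p, p = (φ τ)⁻¹ • (f + τ • v) := ⟨_, rfl⟩
    have hpn : ‖p‖ = 1 := hp ▸ hunit τ
    have hLp : L p = (φ τ)⁻¹ := by rw [hp, map_smul, hLτ, smul_eq_mul, mul_one]
    have hLp0 : 0 < L p := by rw [hLp]; exact inv_pos.2 (one_pos.trans_le (hφ1 τ))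
    have hfp : f + τ • v = φ τ • p := by
      rw [hp, smul_smul, mul_inv_cancel₀ (hφ0 τ), one_smul]
    have hv0 : v ≠ 0 := by rintro rfl; simp at hcv
    have hpv : LinearIndependent ℝ ![p, v] := by
      refine LinearIndependent.pair_iff.2 fun s t hst => ?_
      have h1 := congrArg L hst
      simp only [map_add, map_smul, smul_eq_mul, hLv, map_zero, mul_zero, add_zero] at h1
      have hs := (mul_eq_zero.1 h1).resolve_right hLp0.ne'
      rw [hs, zero_smul, zero_add] at hst
      exact ⟨hs, (smul_eq_zero.1 hst).resolve_right hv0⟩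
    obtain ⟨α, β, M, hβ, hy1, hM, hMp, hMy⟩ := hB.exists_segment hpn hpv
    have hMτ : M (f + τ • v) = φ τ := by
      rw [hfp, map_smul, hMp, smul_eq_mul, mul_one]
    have hMadd : ∀ y : ℝ, M (f + y • v) = φ τ + M v * (y - τ) := by
      intro y
      have : f + y • v = (f + τ • v) + (y - τ) • v := by module
      rw [this, map_add, hMτ, map_smul, smul_eq_mul, mul_comm]
    refine ⟨M v, fun y => ?_, ?_⟩
    · rw [← hMadd]; exact le_norm_of_norm_le_one hM.le _
    -- The far end of the segment may lie on the wrong side of ker L. A small t keeps the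
    -- coefficient of p positive, so q can be rescaled onto the line f + ℝv.
    · obtain ⟨t, ht0, ht1, htpos⟩ : ∃ t : ℝ, 0 < t ∧ t < 1 ∧ 0 < 1 - t + t * α := by
        refine ⟨1 / (2 + |α|), by positivity, ?_, ?_⟩
        · rw [div_lt_one (by positivity)]; linarith [abs_nonneg α]
        · have h1 : 1 - 1 / (2 + |α|) + 1 / (2 + |α|) * α = (1 + (|α| + α)) / (2 + |α|) := by
            field_simp; ring
          rw [h1]
          have := neg_abs_le α
          exact div_pos (by linarith) (by positivity)
      set a := 1 - t + t * α with ha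
      set q := (1 - t) • p + t • (α • p + β • v) with hq
      have hMq : M q = 1 := by
        rw [hq, map_add, map_smul, map_smul, hMp, hMy]; simp
      have hq1 : ‖q‖ ≤ 1 := by
        refine (norm_add_le _ _).trans ?_
        rw [norm_smul, norm_smul, hpn, hy1, Real.norm_of_nonneg ht0.le,
          Real.norm_of_nonneg (by linarith)]
        linarith
      set k := φ τ / a with hk
      have hk0 : 0 < k := div_pos (one_pos.trans_le (hφ1 τ)) htpos
      set y := τ + k * (t * β) with hy
      have hqy : f + y • v = k • q := by
        have h1 : f + y • v = (f + τ • v) + (k * (t * β)) • v := by rw [hy]; module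
        have h2 : φ τ = k * a := by rw [hk, div_mul_cancel₀ _ htpos.ne']
        rw [h1, hfp, h2, hq, ha]; module
      refine ⟨y, ?_, ?_⟩
      · have : k * (t * β) ≠ 0 := by positivity
        intro h; exact this (by linarith)
      · rw [← hMadd]
        refine le_antisymm ?_ (le_norm_of_norm_le_one hM.le _)
        rw [hqy, map_smul, hMq, smul_eq_mul, mul_one, ← mul_one k]
        simp only [hφ, hqy, norm_smul, Real.norm_of_nonneg hk0.le]
        exact mul_le_mul_of_nonneg_left hq1 hk0.le
  have hdiff : ∀ τ ∈ U, DifferentiableAt ℝ φ τ := fun τ hτ =>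
    (hd τ hτ).choose_spec.1.differentiableAt
  have hφ00 : φ 0 = 1 := by simp [hφ, hf]
  have hderiv0 : deriv φ 0 = 0 :=
    IsLocalMin.deriv_eq_zero (Filter.Eventually.of_forall fun y => by rw [hφ00]; exact hφ1 y)
  have hconst : ∀ τ ∈ U, φ τ = 1 := by
    intro τ hτ
    rw [← hφ00]
    refine hUo.is_const_of_deriv_eq_zero hUc.isPreconnected
      (fun x hx => (hdiff x hx).differentiableWithinAt) (fun x hx => ?_) hτ h0U
    rw [hφconv.deriv_eq_of_forall_exists_affine hUo hUc.ordConnected hdiff haff hx h0U, hderiv0]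
    rfl
  -- Since `φ` is constantly 1 on U, U is also closed and hence the whole line, although `φ` is
  -- unbounded.
  have hUeq : U = {τ | φ τ ≤ 1} := by
    ext τ
    refine ⟨fun h => (hconst τ h).le, fun h => ?_⟩
    have h1 : φ τ ≤ 1 := h
    exact lt_of_le_of_lt h1 (by rwa [lt_div_iff₀ hb0, one_mul])
  have hUcl : IsClosed U := by
    rw [hUeq]; exact isClosed_le (by fun_prop) continuous_const
  have hUuniv : U = Set.univ := IsClopen.eq_univ ⟨hUcl, hUo⟩ ⟨0, h0U⟩
  have hvpos : 0 < ‖v‖ := norm_pos_iff.2 (by rintro rfl; simp at hcv)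
  have h1 := hconst (3 / ‖v‖) (hUuniv ▸ Set.mem_univ _)
  have h2 : ‖(3 / ‖v‖) • v‖ = 3 := by
    rw [norm_smul, norm_div, norm_norm, div_mul_cancel₀ _ hvpos.ne']; norm_num
  have h3 : ‖(3 / ‖v‖) • v‖ ≤ φ (3 / ‖v‖) + ‖f‖ := by
    have : (3 / ‖v‖) • v = (f + (3 / ‖v‖) • v) - f := by abel
    rw [this]
    exact norm_sub_le _ _
  rw [h2, h1, hf] at h3
  norm_num at h3

end

/-! ### Exposed faces and the conclusion -/

section

variable {B : Type*} [NormedAddCommGroup B] [NormedSpace ℝ B]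

theorem sSup_image_closedBall_eq {L : StrongDual ℝ B} {r : ℝ} {x : B} (hx : ‖x‖ ≤ r)
    (hLx : L x = ‖L‖ * r) : sSup (L '' Metric.closedBall (0 : B) r) = ‖L‖ * r := by
  refine IsGreatest.csSup_eq ⟨⟨x, by simpa using hx, hLx⟩, ?_⟩
  rintro _ ⟨y, hy, rfl⟩
  refine (le_abs_self _).trans ((L.le_opNorm y).trans ?_)
  exact mul_le_mul_of_nonneg_left (by simpa using hy) (norm_nonneg L)

theorem Exposes.norm_eq_and_map_eq {L : StrongDual ℝ B} {r : ℝ} {F : Set B} (hF : Exposes L r F)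
    (hr : 0 < r) (hL : L ≠ 0) {f : B} (hf : f ∈ F) : ‖f‖ = r ∧ L f = ‖L‖ * r := by
  rw [hF] at hf
  obtain ⟨hfr, hLf⟩ := hf
  have hfr' : ‖f‖ ≤ r := by simpa using hfr
  have hbdd : BddAbove (L '' Metric.closedBall (0 : B) r) := by
    refine ⟨‖L‖ * r, ?_⟩
    rintro _ ⟨y, hy, rfl⟩
    refine (le_abs_self _).trans ((L.le_opNorm y).trans ?_)
    exact mul_le_mul_of_nonneg_left (by simpa using hy) (norm_nonneg L)
  have hle : ∀ y : B, ‖y‖ ≤ r → L y ≤ L f := fun y hy => by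
    rw [hLf]; exact le_csSup hbdd ⟨y, by simpa using hy, rfl⟩
  have h0 : 0 ≤ L f := by simpa using hle 0 (by simpa using hr.le)
  have h1 : ‖L‖ ≤ L f / r := by
    refine ContinuousLinearMap.opNorm_le_of_unit_norm (by positivity) fun y hy => ?_
    have h2 := hle (r • y) (by rw [norm_smul, hy, mul_one, Real.norm_of_nonneg hr.le])
    have h3 := hle ((-r) • y) (by rw [norm_smul, hy, mul_one, norm_neg, Real.norm_of_nonneg hr.le])
    rw [map_smul, smul_eq_mul] at h2 h3
    rw [Real.norm_eq_abs, le_div_iff₀ hr]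
    rcases abs_cases (L y) with h | h <;> rw [h.1] <;> linarith
  rw [le_div_iff₀ hr] at h1
  have hLpos : 0 < ‖L‖ := norm_pos_iff.2 hL
  have h2 : L f ≤ ‖L‖ * ‖f‖ := (le_abs_self _).trans (L.le_opNorm f)
  have h3 : ‖f‖ = r := le_antisymm hfr' (le_of_mul_le_mul_left (h1.trans h2) hLpos)
  exact ⟨h3, le_antisymm (h3 ▸ h2) h1⟩

/-- Exposure depends only on the ray of the functional; this allows normalising to norm one and
rescaling to norm r, as membership in `dualityMap` requires. -/
theorem Exposes.smul {L : StrongDual ℝ B} {r : ℝ} {F : Set B} (hF : Exposes L r F)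
    (hr : 0 < r) (hL : L ≠ 0) {f : B} (hf : f ∈ F) {k : ℝ} (hk : 0 < k) :
    Exposes (k • L) r F := by
  obtain ⟨h1, h2⟩ := hF.norm_eq_and_map_eq hr hL hf
  have h3 : (k • L) f = ‖k • L‖ * r := by
    rw [norm_smul, Real.norm_of_nonneg hk.le, smul_apply, smul_eq_mul, h2, mul_assoc]
  unfold Exposes at hF ⊢
  rw [sSup_image_closedBall_eq h1.le h2] at hF
  rw [sSup_image_closedBall_eq h1.le h3, hF, norm_smul, Real.norm_of_nonneg hk.le]
  ext x
  refine and_congr_right fun _ => ?_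
  rw [smul_apply, smul_eq_mul, mul_assoc, mul_right_inj' hk.ne']

/-- The tangential bound makes a point of a face a minimiser over the supporting hyperplane. -/
theorem TangentialBound.le_of_map_eq {Ω : B → ℝ} {r : ℝ} {F : Set B} {f : B}
    (hT : TangentialBound Ω r F f) (hr : 0 < r) {M : StrongDual ℝ B} (hM : ‖M‖ = 1)
    (hMF : Exposes M r F) (hf : f ∈ F) {g : B} (hg : M g = r) : Ω f ≤ Ω g := by
  have hM0 : M ≠ 0 := norm_ne_zero_iff.1 (by rw [hM]; exact one_ne_zero)
  obtain ⟨h1, h2⟩ := hMF.norm_eq_and_map_eq hr hM0 hf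
  rw [hM, one_mul] at h2
  have hrM : ‖r • M‖ = r := by rw [norm_smul, hM, mul_one, Real.norm_of_nonneg hr.le]
  have := hT (r • M) ⟨by rw [smul_apply, h2, hrM, h1, smul_eq_mul], by rw [hrM, h1]⟩
    (hMF.smul hr hM0 hf hr) (g - f) (by simp [hg, h2])
  rwa [add_sub_cancel] at this

/-- Sublevel sets of a function that is tangentially nondecreasing at its minima over faces are
face-closed. -/
theorem MinimaTangentiallyNondecreasing.isFaceClosed {Ω : B → ℝ}
    (hΩ : MinimaTangentiallyNondecreasing Ω) (m : ℝ) : IsFaceClosed {g | Ω g < m} := by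
  rintro g hg M ⟨hM, x, hx, hMx⟩ ht
  set t := M g with htdef
  set F : Set B := {x ∈ Metric.closedBall (0 : B) t |
    M x = sSup (M '' Metric.closedBall (0 : B) t)} with hF
  have hMF : Exposes M t F := rfl
  have hM0 : M ≠ 0 := norm_ne_zero_iff.1 (by rw [hM]; exact one_ne_zero)
  have htx : ‖t • x‖ ≤ t := by rw [norm_smul, hx, mul_one, Real.norm_of_nonneg ht.le]
  have hMtx : M (t • x) = ‖M‖ * t := by rw [map_smul, hMx, hM, smul_eq_mul, mul_comm]
  have hne : F.Nonempty :=
    ⟨t • x, by simpa using htx, by rw [sSup_image_closedBall_eq htx hMtx, hMtx]⟩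
  obtain ⟨⟨h, hhF, hmin⟩, hT⟩ := hΩ t ht F ⟨hne, M, hM0, hMF⟩
  obtain ⟨h1, h2⟩ := hMF.norm_eq_and_map_eq ht hM0 hhF
  rw [hM, one_mul] at h2
  exact ⟨h, ((hT h hhF hmin).le_of_map_eq ht hM hMF hhF htdef.symm).trans_lt hg, h1, h2⟩

/-- In a uniformly non-rotund space, a face-closed set containing a point `g` meets every
supporting hyperplane of the balls of radius smaller than `‖g‖`. -/
theorem IsFaceClosed.exists_map_eq [CompleteSpace B] {D : Set B} (hD : IsFaceClosed D)
    (hdim : 2 ≤ Module.rank ℝ B) (hB : UniformlyNonRotund B) {L : StrongDual ℝ B}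
    (hL : IsUnitNormAttaining L) {r : ℝ} (hr : 0 < r) {g : B} (hg : g ∈ D) (hrg : r < ‖g‖) :
    ∃ h ∈ D, L h = r := by
  obtain ⟨hL1, f, hf, hLf⟩ := hL
  by_cases hker : ∃ v w : B, L v = 0 ∧ L w = 0 ∧ LinearIndependent ℝ ![v, w]
  · obtain ⟨v, w, hv, hw, hvw⟩ := hker
    obtain ⟨p, M, hp, hLp, hM, hMp, hne⟩ := hB.exists_corner_of_kernel hL1 hf hLf hv hw hvw
    obtain ⟨h, hhD, -, hLh, -⟩ := hD.exists_mem_corner hdim hL1 hM hne.symm hp hLp hMp hr hg hrg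
    exact ⟨h, hhD, hLh⟩
  push Not at hker
  obtain ⟨v, hv0, hLv⟩ := exists_ne_zero_map_eq_zero hdim L
  obtain ⟨K, -, hKv⟩ := exists_dual_vector ℝ v (norm_ne_zero_iff.2 hv0)
  have hKv0 : K v ≠ 0 := by
    rw [hKv]; simpa using hv0
  -- Here ker L is a line, so B is a plane, and c is the coordinate along v in the basis f, v.
  set c : StrongDual ℝ B := (K v)⁻¹ • (K - K f • L) with hc
  have hcf : c f = 0 := by simp [hc, hLf]
  have hcv : c v = 1 := by simp [hc, hLv, hKv0]
  have hkerv : ∀ x : B, L x = 0 → x = c x • v := by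
    intro x hx
    have h1 := hker v x hLv hx
    rw [LinearIndependent.pair_iff' hv0] at h1
    push Not at h1
    obtain ⟨a, rfl⟩ := h1
    rw [map_smul, hcv, smul_eq_mul, mul_one]
  have hspan : ∀ x : B, x = L x • f + c x • v := by
    intro x
    have h1 := hkerv (x - L x • f) (by simp [hLf])
    rw [map_sub, map_smul, hcf, smul_zero, sub_zero] at h1
    rw [← h1]; abel
  have hg0 : 0 < ‖g‖ := hr.trans hrg
  obtain ⟨p, M₁, M₂, hp, hbp, hM₁, hM₂, hne, hM₁p, hM₂p⟩ := hB.exists_corner_of_plane hL1 hf hLf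
    hLv hcf hcv hspan (div_pos hr hg0) ((div_lt_one hg0).2 hrg)
  have hLp : 0 < L p := (div_pos hr hg0).trans hbp
  obtain ⟨h, hhD, -, h1, h2⟩ := hD.exists_mem_corner hdim hM₁ hM₂ hne hp hM₁p hM₂p
    (div_pos hr hLp) hg (by rw [div_lt_iff₀ hLp, mul_comm]; rwa [div_lt_iff₀ hg0] at hbp)
  refine ⟨h, hhD, ?_⟩
  set z := h - (r / L p) • p with hz
  suffices hLz : L z = 0 by
    rw [hz, map_sub, map_smul, smul_eq_mul, div_mul_cancel₀ _ hLp.ne'] at hLz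
    linarith
  -- In a plane the distinct M₁ and M₂ agree only on the line through p. If L z ≠ 0, their
  -- difference would also vanish on the nonzero vector y of ker L, hence everywhere.
  by_contra hLz
  have hM₁z : M₁ z = 0 := by simp [hz, h1, hM₁p]
  have hM₂z : M₂ z = 0 := by simp [hz, h2, hM₂p]
  set E := M₁ - M₂ with hE
  have hEp : E p = 0 := by simp [hE, hM₁p, hM₂p]
  have hEz : E z = 0 := by simp [hE, hM₁z, hM₂z]
  set y := p - (L p / L z) • z with hy
  have hLy : L y = 0 := by
    rw [hy, map_sub, map_smul, smul_eq_mul, div_mul_cancel₀ _ hLz, sub_self]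
  have hM₁y : M₁ y = 1 := by simp [hy, hM₁p, hM₁z]
  have hyv := hkerv y hLy
  have hcy : c y ≠ 0 := by
    intro h0
    rw [h0, zero_smul] at hyv
    rw [hyv, map_zero] at hM₁y
    exact zero_ne_one hM₁y
  have hEv : E v = 0 := by
    have h3 : E y = 0 := by simp [hy, hEp, hEz]
    rw [hyv, map_smul, smul_eq_mul] at h3
    exact (mul_eq_zero.1 h3).resolve_left hcy
  have hEf : E f = 0 := by
    have h3 := hEp
    rw [hspan p, map_add, map_smul, map_smul, hEv, smul_zero, add_zero, smul_eq_mul] at h3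
    exact (mul_eq_zero.1 h3).resolve_left hLp.ne'
  refine hne (sub_eq_zero.1 (ContinuousLinearMap.ext fun x => ?_))
  rw [← hE, hspan x]
  simp [hEf, hEv]

end

theorem lemma2p5 {B : Type*} [NormedAddCommGroup B] [NormedSpace ℝ B] [CompleteSpace B]
    (hdim : 2 ≤ Module.rank ℝ B) (hB : UniformlyNonRotund B)
    (Ω : B → ℝ) (hΩ : MinimaTangentiallyNondecreasing Ω)
    (fhat : B) (hfhat : IsAdmissiblePoint Ω fhat)
    (f : B) (hf : ‖fhat‖ < ‖f‖) :
    Ω fhat ≤ Ω f := by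
  obtain ⟨r, F, hr, ⟨-, L, hL0, hLF⟩, hfF, -, hT⟩ := hfhat
  rcases hr.eq_or_lt with rfl | hr
  -- At radius 0 the zero functional lies in J(0) and exposes {0}; its kernel is the whole space, so
  -- the bound is global.
  · have hsub : ∀ x ∈ F, x = 0 := fun x hx => by
      rw [hLF] at hx
      simpa using hx.1
    have h0 := hsub fhat hfF
    subst h0
    have hF0 : Exposes (0 : StrongDual ℝ B) 0 F := by
      unfold Exposes
      ext x
      refine ⟨fun hx => ?_, fun hx => ?_⟩
      · rw [hsub x hx]; simp
      · have : x = 0 := by simpa using hx.1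
        rwa [this]
    simpa using hT 0 (by simp [dualityMap]) hF0 f rfl
  · have hLpos : 0 < ‖L‖ := norm_pos_iff.2 hL0
    obtain ⟨hfr, hLf⟩ := hLF.norm_eq_and_map_eq hr hL0 hfF
    have hMF := hLF.smul hr hL0 hfF (inv_pos.2 hLpos)
    have hM1 : ‖‖L‖⁻¹ • L‖ = 1 := by
      rw [norm_smul, norm_inv, norm_norm, inv_mul_cancel₀ hLpos.ne']
    have hMf : (‖L‖⁻¹ • L) (r⁻¹ • fhat) = 1 := by
      rw [smul_apply, map_smul, hLf, smul_eq_mul, smul_eq_mul]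
      field_simp
    by_contra! hlt
    obtain ⟨h, hh, hMh⟩ := (hΩ.isFaceClosed (Ω fhat)).exists_map_eq hdim hB
      ⟨hM1, r⁻¹ • fhat, by rw [norm_smul, hfr, Real.norm_of_nonneg (by positivity),
        inv_mul_cancel₀ hr.ne'], hMf⟩ hr hlt (hfr ▸ hf)
    exact absurd (hT.le_of_map_eq hr hM1 hMF hfF hMh) (not_le.2 hh)
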